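/- Let $k$ be an algebraically closed field of characteristic $p>0$. A normal variety over $k$ is a normal integral separated scheme of finite type over $k$. Let $g\colon X'\to X$ be a finite separable morphism of normal varieties over $k$, i.e. a finite dominant $k$-morphism whose extension of function fields $k(X')/k(X)$ is separable. Let $\Delta$ and $\Delta'$ be $\mathbb{Q}$-Weil divisors (not necessarily effective) on $X$ and $X'$. Let $\omega$ be a non-zero rational differential form of top degree on $X$, and take the canonical divisors $K_X=\operatorname{div}(\omega)$ and $K_{X'}=\operatorname{div}(g^*\omega)$. Assume that $K_X+\Delta$ is $\mathbb{Q}$-Cartier and that $$g^{*}(K_X+\Delta)=K_{X'}+\Delta'$$ as $\mathbb{Q}$-divisors. If $(X,\Delta)$ is log canonical, then $(X',\Delta')$ is log canonical. Here, for a $\mathbb{Q}$-divisor $\Delta$ on a normal variety $X$, the pair $(X,\Delta)$ is log canonical if $K_X+\Delta$ is $\mathbb{Q}$-Cartier and, for every birational morphism $\pi\colon Y\to X$ over $k$ from a normal variety $Y$ and every prime divisor $E$ on $Y$, the discrepancy $a(E;X,\Delta)$ is at least $-1$. The discrepancy is the coefficient of $E$ in $K_Y-\pi^{*}(K_X+\Delta)$,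 where $K_X=\operatorname{div}(\omega)$ and $K_Y=\operatorname{div}(\pi^*\omega)$ for a non-zero rational top form $\omega$ on $X$; this does not depend on $\omega$. -/

import Mathlib

open CategoryTheory AlgebraicGeometry

universe u

noncomputable section

/-! ### Pulling back differential forms along an extension of `k`-algebras -/

/-- The pull-back of differential forms `⋀ Ω_{A/k} → ⋀ Ω_{B/k}` induced by a homomorphism
`φ : A → B` of `k`-algebras: `a₀ da₁ ∧ ⋯ ∧ daₙ ↦ φ(a₀) dφ(a₁) ∧ ⋯ ∧ dφ(aₙ)`. -/
def formPullback {k A B : Type u} [CommRing k] [CommRing A] [CommRing B] [Algebra k A]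
    [Algebra k B] (φ : A →ₐ[k] B) :
    ExteriorAlgebra A (KaehlerDifferential k A) →+*
      ExteriorAlgebra B (KaehlerDifferential k B) :=
  letI : Algebra A B := φ.toRingHom.toAlgebra
  haveI : IsScalarTower k A B := IsScalarTower.of_algebraMap_eq fun r => (φ.commutes r).symm
  (ExteriorAlgebra.lift A
    ⟨(ExteriorAlgebra.ι B).restrictScalars A ∘ₗ KaehlerDifferential.map k k A B,
      fun m => ExteriorAlgebra.ι_sq_zero (R := B) (KaehlerDifferential.map k k A B m)⟩ :
    ExteriorAlgebra A (KaehlerDifferential k A) →ₐ[A]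
      ExteriorAlgebra B (KaehlerDifferential k B)).toRingHom

/-! ### Normal varieties -/

/-- A normal variety over a field `k`: an integral separated scheme of finite type over `k` all of
whose local rings are integrally closed. -/
structure NormalVariety (k : Type u) [Field k] where
  /-- The underlying scheme. -/
  toScheme : Scheme.{u}
  /-- The structure morphism. -/
  str : toScheme ⟶ Spec (CommRingCat.of k)
  isIntegral : IsIntegral toScheme
  isSeparated : IsSeparated str
  locallyOfFiniteType : LocallyOfFiniteType str
  quasiCompact : QuasiCompact str
  isIntegrallyClosed_stalk : ∀ x : toScheme, IsIntegrallyClosed (toScheme.presheaf.stalk x)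

namespace NormalVariety

variable {k : Type u} [Field k]

instance (X : NormalVariety k) : IsIntegral X.toScheme := X.isIntegral

instance (X : NormalVariety k) : IsLocallyNoetherian X.toScheme :=
  haveI := X.locallyOfFiniteType
  LocallyOfFiniteType.isLocallyNoetherian X.str

/-- The field `k(X)` of rational functions on `X`. -/
abbrev FunctionField (X : NormalVariety k) : Type u := X.toScheme.functionField

/-- The homomorphism `k → Γ(X, ⊤)` given by the structure morphism. -/
def scalars (X : NormalVariety k) : CommRingCat.of k ⟶ Γ(X.toScheme, ⊤) :=
  (Scheme.ΓSpecIso (CommRingCat.of k)).inv ≫ X.str.appTop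

instance (X : NormalVariety k) : Algebra k X.FunctionField :=
  (X.scalars ≫ X.toScheme.presheaf.germ ⊤ (genericPoint X.toScheme)
    (TopologicalSpace.Opens.mem_top _)).hom.toAlgebra

/-- A prime divisor on `X`, given by its generic point, a point of codimension one. -/
def PrimeDivisor (X : NormalVariety k) : Type u := {x : X.toScheme // Order.coheight x = 1}

/-- The order of vanishing of a rational function along a prime divisor. -/
def ord (X : NormalVariety k) (f : X.FunctionField) (E : X.PrimeDivisor) : ℤ :=
  X.toScheme.ord f E.1

/-- `ℚ`-Weil divisors: finite formal sums of prime divisors with rational coefficients. -/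
abbrev QDivisor (X : NormalVariety k) : Type u := X.PrimeDivisor →₀ ℚ

/-! ### Rational differential forms and canonical divisors -/

/-- Rational differential forms on `X` (of all degrees), i.e. the exterior algebra of `Ω_{k(X)/k}`
over `k(X)`. -/
abbrev RationalForm (X : NormalVariety k) : Type u :=
  ExteriorAlgebra X.FunctionField (KaehlerDifferential k X.FunctionField)

/-- The degree of the highest non-vanishing exterior power of `Ω_{k(X)/k}`, which is the dimension
of `X` when `k` is perfect. -/
def topDegree (X : NormalVariety k) : ℕ :=
  Module.finrank X.FunctionField (KaehlerDifferential k X.FunctionField)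

/-- `ω` is a non-zero rational differential form of top degree on `X`. -/
def IsTopForm (X : NormalVariety k) (ω : X.RationalForm) : Prop :=
  ω ∈ ⋀[X.FunctionField]^X.topDegree (KaehlerDifferential k X.FunctionField) ∧ ω ≠ 0

/-- The rational forms of top degree that are regular at `x`: the image of the top exterior power
of `Ω_{𝒪_{X,x}/k}`, that is, the `𝒪_{X,x}`-linear combinations of `da₁ ∧ ⋯ ∧ daₙ` with
`a₁, …, aₙ ∈ 𝒪_{X,x}`. -/
def regularForms (X : NormalVariety k) (x : X.toScheme) :
    Submodule (X.toScheme.presheaf.stalk x) X.RationalForm :=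
  Submodule.span _ (Set.range fun a : Fin X.topDegree → X.toScheme.presheaf.stalk x =>
    ExteriorAlgebra.ιMulti X.FunctionField X.topDegree fun i =>
      KaehlerDifferential.D k X.FunctionField (algebraMap _ X.FunctionField (a i)))

/-- The order of a rational form `ω` of top degree along a prime divisor `E`: the largest integer
`m` such that `ω = f • η` with `f` a rational function of order `m` along `E` and `η` a form that is
regular at the generic point of `E`. The divisor `∑ ordForm ω E • E` is the canonical divisor
`K_X = div ω`. -/
def ordForm (X : NormalVariety k) (ω : X.RationalForm) (E : X.PrimeDivisor) : ℤ :=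
  sSup {m : ℤ | ∃ f : X.FunctionField, f ≠ 0 ∧ X.ord f E = m ∧ f⁻¹ • ω ∈ X.regularForms E.1}

/-- The coefficients of the divisor `K_X + Δ`, where `K_X = div ω`. -/
def logCanonicalDivisor (X : NormalVariety k) (ω : X.RationalForm) (Δ : X.QDivisor) :
    X.PrimeDivisor → ℚ :=
  fun E => X.ordForm ω E + Δ E

/-! ### `ℚ`-Cartier divisors -/

/-- `f` is an equation of `m D` in a neighbourhood of the point `x`. -/
def IsLocalEquation (X : NormalVariety k) (D : X.PrimeDivisor → ℚ) (x : X.toScheme) (m : ℕ)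
    (f : X.FunctionField) : Prop :=
  0 < m ∧ f ≠ 0 ∧ ∃ U : X.toScheme.Opens, x ∈ U ∧
    ∀ E : X.PrimeDivisor, E.1 ∈ U → (m : ℚ) * D E = X.ord f E

/-- `D` is `ℚ`-Cartier: some positive multiple `m D` is locally principal. -/
def IsQCartier (X : NormalVariety k) (D : X.PrimeDivisor → ℚ) : Prop :=
  ∃ m : ℕ, 0 < m ∧ ∀ x : X.toScheme, ∃ f : X.FunctionField, X.IsLocalEquation D x m f

/-! ### Dominant morphisms -/

/-- A dominant morphism of normal varieties over `k`. -/
structure DominantMorphism (Y X : NormalVariety k) where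
  /-- The underlying morphism of schemes. -/
  hom : Y.toScheme ⟶ X.toScheme
  comp_str : hom ≫ X.str = Y.str
  isDominant : IsDominant hom

namespace DominantMorphism

variable {X Y : NormalVariety k}

theorem map_genericPoint (φ : DominantMorphism Y X) :
    φ.hom (genericPoint Y.toScheme) = genericPoint X.toScheme := by
  have := φ.isDominant
  apply IsGenericPoint.eq _ (genericPoint_spec X.toScheme)
  have h := (genericPoint_spec Y.toScheme).image φ.hom.continuous
  rwa [Set.image_univ, φ.hom.denseRange.closure_range] at h

/-- The pull-back `k(X) → k(Y)` of rational functions, as a ring homomorphism: the map on the local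
rings at the generic points. -/
def functionFieldHom (φ : DominantMorphism Y X) :
    X.toScheme.functionField ⟶ Y.toScheme.functionField :=
  X.toScheme.presheaf.stalkSpecializes (specializes_of_eq φ.map_genericPoint) ≫
    φ.hom.stalkMap (genericPoint Y.toScheme)

/-- The pull-back `k(X) → k(Y)` of rational functions. -/
def functionFieldMap (φ : DominantMorphism Y X) : X.FunctionField →ₐ[k] Y.FunctionField where
  toRingHom := φ.functionFieldHom.hom
  commutes' r := by
    have h : X.scalars ≫
        X.toScheme.presheaf.germ ⊤ (genericPoint X.toScheme) (TopologicalSpace.Opens.mem_top _) ≫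
        φ.functionFieldHom =
        Y.scalars ≫
        Y.toScheme.presheaf.germ ⊤ (genericPoint Y.toScheme) (TopologicalSpace.Opens.mem_top _) := by
      have hs : Y.scalars = X.scalars ≫ φ.hom.appTop := by
        simp [scalars, ← φ.comp_str]
      rw [hs, functionFieldHom, TopCat.Presheaf.germ_stalkSpecializes_assoc,
        Scheme.Hom.germ_stalkMap]
      simp
    exact congrArg (fun f : CommRingCat.of k ⟶ Y.toScheme.functionField => f.hom r) h

/-- The coefficients of the pull-back `φ^* D` of a `ℚ`-Cartier divisor: if `f` is an equation of
`m D` around the image of the generic point of `E`, then the coefficient of `φ^* D` along `E` is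
`ord_E(φ^* f) / m`. As `X` is normal, this does not depend on `m` and `f`. -/
def pullback (φ : DominantMorphism Y X) (D : X.PrimeDivisor → ℚ) : Y.PrimeDivisor → ℚ :=
  open scoped Classical in
  fun E =>
    if h : ∃ p : ℕ × X.FunctionField, X.IsLocalEquation D (φ.hom E.1) p.1 p.2 then
      (Y.ord (φ.functionFieldMap h.choose.2) E : ℚ) / h.choose.1
    else 0

/-- The pull-back of rational differential forms. -/
def pullbackForm (φ : DominantMorphism Y X) (ω : X.RationalForm) : Y.RationalForm :=
  formPullback φ.functionFieldMap ω

/-- A dominant morphism is separable if it induces a separable extension of function fields. -/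
def IsSeparable (φ : DominantMorphism Y X) : Prop :=
  letI : Algebra X.FunctionField Y.FunctionField := φ.functionFieldMap.toRingHom.toAlgebra
  Algebra.IsSeparable X.FunctionField Y.FunctionField

/-- A dominant morphism of varieties is birational if it induces an isomorphism of function
fields. -/
def IsBirational (φ : DominantMorphism Y X) : Prop :=
  Function.Bijective φ.functionFieldMap

end DominantMorphism

/-! ### Discrepancies and log canonical pairs -/

/-- The discrepancy `a(E; X, Δ)` of a prime divisor `E` on `Y`, for a birational morphism
`π : Y → X`: the coefficient of `K_Y - π^*(K_X + Δ)` along `E`, where `K_X = div ω` and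
`K_Y = div (π^* ω)` for a rational form `ω` of top degree on `X`. -/
def discrepancy {X Y : NormalVariety k} (π : DominantMorphism Y X) (ω : X.RationalForm)
    (Δ : X.QDivisor) (E : Y.PrimeDivisor) : ℚ :=
  Y.ordForm (π.pullbackForm ω) E - π.pullback (X.logCanonicalDivisor ω Δ) E

/-- The pair `(X, Δ)` is log canonical: `K_X + Δ` is `ℚ`-Cartier and every discrepancy is at
least `-1`. None of this depends on the rational form `ω` that represents the canonical class. The
divisor `Δ` is not required to be effective. -/
def IsLogCanonical (X : NormalVariety k) (Δ : X.QDivisor) : Prop :=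
  ∀ ω : X.RationalForm, X.IsTopForm ω →
    X.IsQCartier (X.logCanonicalDivisor ω Δ) ∧
    ∀ (Y : NormalVariety k) (π : DominantMorphism Y X), π.IsBirational →
      ∀ E : Y.PrimeDivisor, -1 ≤ discrepancy π ω Δ E

end NormalVariety

end

/-! Let `π : Y → X'` be birational and `E` a prime divisor on `Y`. Since `g^*(K_X + Δ) = K_{X'} +
Δ'`, the discrepancy of `E` over `X'` is the coefficient of `E` in `K_Y - (g ∘ π)^*(K_X + Δ)`. So it
suffices to bound this coefficient below by `-1` for every dominant separable morphism `φ : Y → X`;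
this is `IsLogCanonical.neg_one_le`.

Restrict the valuation of `E` to `k(X)`. By `exists_birational_model`, the restriction is the
valuation of a prime divisor `F` on a normal variety `Z` birational over `X`. If `e` is the
ramification index, pulled-back functions have order `e` times as large along `E` as along `F`,
while `mul_dvrOrdForm_add_one_le` gives `e (ord_F ω + 1) ≤ ord_E ω + 1`. Together, `a(E) + 1 ≥ e
(a(F) + 1) ≥ 0`.

The inequality for forms is local. At a discrete valuation ring essentially of finite type over a
perfect field, the regular top forms are generated by one form `dx₁ ∧ ⋯ ∧ dxₙ` in which some `xᵢ` is
a uniformizer (`exists_span_D_eq_top`, `exists_generator`). Upstairs `xᵢ = u s^e`, and `d(u s^e)` is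
divisible by `s^(e-1)`, whatever the characteristic. Wild ramification only raises the order
further, so an inequality is what survives.

The variety `Z` is built directly, without resolving or blowing up. Residue fields extend
algebraically, so the restricted valuation ring `R` of `K = k(X)` has a residue field of
transcendence degree one less than that of `K`. Lifts of a transcendence basis of the residue field
and an element `t` of the maximal ideal can be chosen with differentials forming a basis of
`Ω_{K/k}` (`exists_linearIndependent_D`). Then `K` is finite separable over the rational function
field `F` which they generate, the integral closure of the polynomial ring in `K` is finite over it,
and `R` is its localization at the centre (`exists_fraction_of_integralClosure`). Inverting one more
element makes this algebra contain the coordinate ring of an affine open set of `X`; its spectrum is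
`Z`. -/

/-! ### Differentials, transcendence degree and algebraic independence. -/

open scoped IntermediateField.algebraAdjoinAdjoin in
/-- If `v` is an algebraically independent family and `L` is separable algebraic over `k(v)`, then
`dim Ω_{L/k}` is the cardinality of `v`. -/
theorem finrank_kaehlerDifferential_of_isSeparable {k L ι : Type u} [Field k] [Field L]
    [Algebra k L]
    {v : ι → L} (hv : AlgebraicIndependent k v)
    [Algebra.IsSeparable (IntermediateField.adjoin k (Set.range v)) L] :
    Module.finrank L (Ω[L⁄k]) = Nat.card ι := by
  let P := MvPolynomial ι k
  let A₀ := Algebra.adjoin k (Set.range v)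
  let F := IntermediateField.adjoin k (Set.range v)
  let : Algebra P A₀ := hv.aevalEquiv.toAlgHom.toRingHom.toAlgebra
  have : IsScalarTower k P A₀ := IsScalarTower.of_algebraMap_eq fun r =>
    (hv.aevalEquiv.commutes r).symm
  let : Algebra P L := ((algebraMap A₀ L).comp (algebraMap P A₀)).toAlgebra
  have : IsScalarTower P A₀ L := IsScalarTower.of_algebraMap_eq fun _ => rfl
  have : IsScalarTower k P L := IsScalarTower.of_algebraMap_eq fun r => by
    rw [IsScalarTower.algebraMap_apply P A₀ L, ← IsScalarTower.algebraMap_apply k P A₀,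
      ← IsScalarTower.algebraMap_apply k A₀ L]
  -- The tower `P ≃ A₀ ⊆ F ⊆ L` consists of an isomorphism, a localization and a separable
  -- extension, all formally étale. So `Ω_{L/k}` is the base change of the free module `Ω_{P/k}`.
  have : Algebra.FormallyEtale P A₀ :=
    Algebra.FormallyEtale.of_equiv (R := P)
      ({ hv.aevalEquiv.toRingEquiv with commutes' := fun _ => rfl } : P ≃ₐ[P] A₀)
  have : Algebra.FormallyEtale A₀ F := Algebra.FormallyEtale.of_isLocalization (nonZeroDivisors A₀)
  have : Algebra.FormallyEtale F L := Algebra.FormallyEtale.of_isSeparable F L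
  have : Algebra.FormallyEtale A₀ L := Algebra.FormallyEtale.comp A₀ F L
  have : Algebra.FormallyEtale P L := Algebra.FormallyEtale.comp P A₀ L
  have e := KaehlerDifferential.tensorKaehlerEquivOfFormallyEtale k P L
  rw [← e.finrank_eq, Module.finrank_baseChange,
    Module.finrank_eq_nat_card_basis (KaehlerDifferential.mvPolynomialBasis k ι)]

/-- Over a perfect field, `dim Ω_{L/k}` is the transcendence degree of `L`. -/
theorem trdeg_eq_finrank_kaehlerDifferential (k L : Type u) [Field k] [Field L] [Algebra k L]
    [PerfectField k] [Algebra.EssFiniteType k L] :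
    Algebra.trdeg k L = Module.finrank L (Ω[L⁄k]) := by
  obtain ⟨s, hs, H⟩ := exists_isTranscendenceBasis_and_isSeparable_of_perfectField k L
  have : Algebra.IsSeparable (IntermediateField.adjoin k (Set.range ((↑) : s → L))) L := by
    convert! H <;> simp
  rw [finrank_kaehlerDifferential_of_isSeparable hs.1, ← hs.cardinalMk_eq_trdeg]
  simp

/-- A nonzero non-unit is transcendental over a subring all of whose nonzero elements are units. -/
theorem transcendental_of_forall_isUnit {A R : Type*} [CommRing A] [CommRing R] [IsDomain R]
    [Algebra A R] (hA : ∀ a : A, a ≠ 0 → IsUnit (algebraMap A R a)) {t : R} (ht : t ≠ 0)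
    (ht' : ¬ IsUnit t) : Transcendental A t := by
  rintro ⟨p, hp, hpt⟩
  -- With the largest power of the variable removed, `q` still vanishes at `t` and has nonzero
  -- constant term. That term is a unit, yet `t` would divide it.
  obtain ⟨q, hq, hq'⟩ := Polynomial.exists_eq_pow_rootMultiplicity_mul_and_not_dvd p hp 0
  rw [map_zero, sub_zero] at hq hq'
  rw [hq] at hpt
  have h1 : Polynomial.aeval t q = 0 := by simpa [ht] using hpt
  have h2 : q.coeff 0 ≠ 0 := fun h => hq' (Polynomial.X_dvd_iff.mpr h)
  have h3 : t ∣ algebraMap A R (q.coeff 0) := by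
    rw [← Polynomial.divX_mul_X_add q] at h1
    simp only [map_add, map_mul, Polynomial.aeval_X, Polynomial.aeval_C] at h1
    exact ⟨-Polynomial.aeval t q.divX, by linear_combination h1⟩
  exact ht' (isUnit_of_dvd_unit h3 (hA _ h2))

/-- Lifts of algebraically independent residues, together with a nonzero element of the maximal
ideal, are algebraically independent. -/
theorem algebraicIndependent_option_of_residue {k R ι : Type*} [Field k] [CommRing R] [IsDomain R]
    [IsLocalRing R] [Algebra k R] {x : ι → R}
    (hx : AlgebraicIndependent k fun i => IsLocalRing.residue R (x i)) {t : R} (ht : t ≠ 0)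
    (ht' : ¬ IsUnit t) : AlgebraicIndependent k (fun o : Option ι => o.elim t x) := by
  have key : ∀ P : MvPolynomial ι k, P ≠ 0 → IsUnit (MvPolynomial.aeval x P) := fun P hP => by
    have h : IsLocalRing.residue R (MvPolynomial.aeval x P) =
        MvPolynomial.aeval (fun i => IsLocalRing.residue R (x i)) P := by
      have := (MvPolynomial.comp_aeval_apply x (IsScalarTower.toAlgHom k R (IsLocalRing.ResidueField R)) P)
      exact this
    have h0 := (injective_iff_map_eq_zero _).mp hx P
    by_contra hu
    exact hP (h0 (h ▸ (IsLocalRing.residue_eq_zero_iff _).mpr hu))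
  have hx' : AlgebraicIndependent k x := by
    refine (injective_iff_map_eq_zero _).mpr fun P hP => ?_
    by_contra h
    exact not_isUnit_zero (hP ▸ key P h)
  rw [hx'.option_iff_transcendental]
  refine transcendental_of_forall_isUnit (fun a ha => ?_) ht ht'
  obtain ⟨P, hP⟩ := hx'.aevalEquiv.surjective a
  have h1 : algebraMap _ R a = MvPolynomial.aeval x P := by
    rw [← hP]; simp
  rw [h1]
  exact key P (by rintro rfl; exact ha (by simp [← hP]))

/-! ### Generators of the differentials of a discrete valuation ring. -/

section

open TensorProduct IsLocalRing

theorem ResidueField.essFiniteType (k R : Type*) [Field k] [CommRing R] [IsLocalRing R]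
    [Algebra k R] [Algebra.EssFiniteType k R] : Algebra.EssFiniteType k (ResidueField R) :=
  .of_surjective (IsScalarTower.toAlgHom k R (ResidueField R)) residue_surjective

/-- The module of differentials of a local ring is generated by the differential of a generator of
the maximal ideal and of lifts of elements whose differentials span the differentials of the
residue field. -/
theorem span_D_option_eq_top {k R : Type u} [Field k] [CommRing R] [IsLocalRing R] [Algebra k R]
    [Algebra.EssFiniteType k R] {ι : Type*} {t : R} (ht : maximalIdeal R = Ideal.span {t})
    {x : ι → R} (hx : Submodule.span (ResidueField R)
      (Set.range fun i => KaehlerDifferential.D k (ResidueField R) (residue R (x i))) = ⊤) :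
    Submodule.span R (Set.range fun o : Option ι => KaehlerDifferential.D k R (o.elim t x)) = ⊤ := by
  -- Nakayama reduces the claim to `κ ⊗ Ω_{R/k}`, with `κ` the residue field. There the span `N`
  -- maps onto `Ω_{κ/k}` and contains the kernel of that map.
  rw [← map_tensorProduct_mk_eq_top, Submodule.map_span, ← Submodule.restrictScalars_span R
    (ResidueField R) Ideal.Quotient.mk_surjective, Submodule.restrictScalars_eq_top_iff]
  set N := Submodule.span (ResidueField R) ((TensorProduct.mk R (ResidueField R) Ω[R⁄k] 1) ''
    Set.range fun o : Option ι => KaehlerDifferential.D k R (o.elim t x)) with hN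
  have hmem : ∀ o : Option ι, (1 : ResidueField R) ⊗ₜ[R] KaehlerDifferential.D k R (o.elim t x) ∈ N :=
    fun o => Submodule.subset_span ⟨_, ⟨o, rfl⟩, rfl⟩
  have hmap : N.map (KaehlerDifferential.mapBaseChange k R (ResidueField R)) = ⊤ := by
    rw [eq_top_iff, ← hx, Submodule.span_le]
    rintro _ ⟨i, rfl⟩
    refine ⟨_, hmem (some i), ?_⟩
    simp
  -- By the conormal sequence the kernel consists of the classes of `dy` with `y` in the maximal
  -- ideal; for `y = t c` this is `c dt`, because `t dc` dies in `κ ⊗ Ω_{R/k}`.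
  have hker : LinearMap.ker (KaehlerDifferential.mapBaseChange k R (ResidueField R)) ≤ N := by
    intro z hz
    have hz' := (KaehlerDifferential.exact_kerCotangentToTensor_mapBaseChange k R (ResidueField R)
      residue_surjective z).mp hz
    obtain ⟨y, rfl⟩ := hz'
    obtain ⟨⟨y, hy⟩, rfl⟩ := Ideal.toCotangent_surjective _ y
    rw [KaehlerDifferential.kerCotangentToTensor_toCotangent]
    have hy' : y ∈ maximalIdeal R := by
      rw [RingHom.mem_ker] at hy
      exact (residue_eq_zero_iff y).mp hy
    rw [ht, Ideal.mem_span_singleton] at hy'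
    obtain ⟨c, rfl⟩ := hy'
    have ht0 : algebraMap R (ResidueField R) t = 0 :=
      (residue_eq_zero_iff t).mpr (ht ▸ Ideal.mem_span_singleton_self t)
    have : (1 : ResidueField R) ⊗ₜ[R] KaehlerDifferential.D k R (t * c) =
        residue R c • ((1 : ResidueField R) ⊗ₜ[R] KaehlerDifferential.D k R t) := by
      rw [Derivation.leibniz, TensorProduct.tmul_add, ← TensorProduct.smul_tmul,
        ← TensorProduct.smul_tmul, Algebra.smul_def, ht0, zero_mul, TensorProduct.zero_tmul,
        zero_add, TensorProduct.smul_tmul', Algebra.smul_def]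
      rfl
    rw [this]
    exact N.smul_mem _ (hmem none)
  rw [eq_top_iff]
  intro z _
  obtain ⟨w, hw, hwz⟩ : KaehlerDifferential.mapBaseChange k R (ResidueField R) z ∈
    N.map (KaehlerDifferential.mapBaseChange k R (ResidueField R)) := hmap ▸ Submodule.mem_top
  have : z - w ∈ N := hker (by simp [hwz])
  simpa using N.add_mem this hw

theorem span_D_algebraMap_eq_top {k R : Type u} (K : Type u) [Field k] [CommRing R] [Algebra k R]
    [Field K] [Algebra R K] [IsFractionRing R K] [Algebra k K] [IsScalarTower k R K]
    {ι : Type*} {x : ι → R}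
    (hx : Submodule.span R (Set.range fun i => KaehlerDifferential.D k R (x i)) = ⊤) :
    Submodule.span K (Set.range fun i => KaehlerDifferential.D k K (algebraMap R K (x i))) = ⊤ := by
  have := span_eq_top_of_isLocalizedModule K (nonZeroDivisors R) (KaehlerDifferential.map k k R K) hx
  rw [← Set.range_comp] at this
  simpa [Function.comp_def] using this

theorem essFiniteType_fractionRing (k R K : Type u) [Field k] [CommRing R] [Algebra k R]
    [Field K] [Algebra R K] [IsFractionRing R K] [Algebra k K] [IsScalarTower k R K]
    [Algebra.EssFiniteType k R] : Algebra.EssFiniteType k K :=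
  have : Algebra.EssFiniteType R K := .of_isLocalization K (nonZeroDivisors R)
  .comp k R K

/-- The differentials of a discrete valuation ring that is essentially of finite type over a perfect
field are generated by those of `n` elements, one of which is a uniformizer, where
`n = dim Ω_{K/k}`; and the residue field has transcendence degree `n - 1`. -/
theorem exists_span_D_eq_top (k R K : Type u) [Field k] [PerfectField k] [CommRing R] [IsDomain R]
    [IsDiscreteValuationRing R] [Algebra k R] [Algebra.EssFiniteType k R]
    [Field K] [Algebra R K] [IsFractionRing R K] [Algebra k K] [IsScalarTower k R K] :
    Algebra.trdeg k (ResidueField R) + 1 = Module.finrank K Ω[K⁄k] ∧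
    ∃ (x : Fin (Module.finrank K Ω[K⁄k]) → R) (i : Fin (Module.finrank K Ω[K⁄k])),
      Irreducible (x i) ∧
      Submodule.span R (Set.range fun i => KaehlerDifferential.D k R (x i)) = ⊤ := by
  have : Algebra.EssFiniteType k K := essFiniteType_fractionRing k R K
  have : Algebra.EssFiniteType k (ResidueField R) := ResidueField.essFiniteType k R
  obtain ⟨t, ht⟩ := IsDiscreteValuationRing.exists_irreducible R
  have htdeg := trdeg_eq_finrank_kaehlerDifferential k (ResidueField R)
  have hKdeg := trdeg_eq_finrank_kaehlerDifferential k K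
  obtain ⟨m, hm⟩ : ∃ m, Module.finrank (ResidueField R) Ω[ResidueField R⁄k] = m := ⟨_, rfl⟩
  obtain ⟨n, hn⟩ : ∃ n, Module.finrank K Ω[K⁄k] = n := ⟨_, rfl⟩
  rw [hm] at htdeg
  rw [hn] at hKdeg ⊢
  obtain ⟨y, hy⟩ : ∃ y : Fin m → R, Submodule.span (ResidueField R)
      (Set.range fun i => KaehlerDifferential.D k (ResidueField R) (residue R (y i))) = ⊤ := by
    have hspan := KaehlerDifferential.span_range_derivation k (ResidueField R)
    obtain ⟨b, hb, hli, -⟩ := Submodule.exists_fun_fin_finrank_span_eq (ResidueField R)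
      (Set.range (KaehlerDifferential.D k (ResidueField R)))
    have hbm : Module.finrank (ResidueField R) (Submodule.span (ResidueField R)
      (Set.range (KaehlerDifferential.D k (ResidueField R)))) = m := by
      rw [hspan, finrank_top, hm]
    choose z hz using hb
    choose y hy using fun i => residue_surjective (R := R) (z i)
    refine ⟨fun i => y (Fin.cast hbm.symm i), ?_⟩
    refine Eq.trans ?_ (hli.trans hspan)
    congr 1
    ext w
    simp only [Set.mem_range, hy, hz]
    exact ⟨fun ⟨i, hi⟩ => ⟨_, hi⟩, fun ⟨i, hi⟩ => ⟨Fin.cast hbm i, hi⟩⟩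
  have hspan := span_D_option_eq_top ht.maximalIdeal_eq hy
  -- The upper bound comes from the spanning family of `m + 1` differentials; the lower bound comes
  -- from `m + 1` algebraically independent elements. Perfectness of `k` makes both counts refer to
  -- transcendence degrees.
  have hle : n ≤ m + 1 := by
    have h1 := finrank_range_le_card (R := K)
      fun o : Option (Fin m) => KaehlerDifferential.D k K (algebraMap R K (o.elim t y))
    rw [Set.finrank, span_D_algebraMap_eq_top K hspan, finrank_top, hn] at h1
    simpa using h1
  have hge : m + 1 ≤ n := by
    obtain ⟨ι, z, hz⟩ := exists_isTranscendenceBasis' k (ResidueField R)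
    choose w hw using fun i => residue_surjective (R := R) (z i)
    have hw' : AlgebraicIndependent k fun i => residue R (w i) := by
      simpa only [hw] using hz.1
    have h2 := (algebraicIndependent_option_of_residue hw' ht.ne_zero ht.not_isUnit).map'
      (f := IsScalarTower.toAlgHom k R K) (IsFractionRing.injective R K)
    have h3 := h2.cardinalMk_le_trdeg
    rw [Cardinal.mk_option, hz.cardinalMk_eq_trdeg, htdeg, hKdeg] at h3
    exact_mod_cast h3
  obtain rfl : n = m + 1 := le_antisymm hle hge
  refine ⟨by rw [htdeg]; norm_cast, fun i => ((finSuccEquiv m) i).elim t y, 0, by simpa using ht, ?_⟩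
  rw [← hspan]
  congr 1
  ext w
  simp only [Set.mem_range]
  exact ((finSuccEquiv m).exists_congr_left (p := _)).trans (by simp)

end

/-! ### Top exterior powers and the order function of a discrete valuation ring. -/

section

open IsLocalRing

/-- A product of `n` vectors in the `R`-span of `x₁, …, xₙ` is an `R`-multiple of
`x₁ ∧ ⋯ ∧ xₙ`. -/
theorem ιMulti_mem_span_singleton {R K M : Type*} [CommRing R] [Field K] [Algebra R K]
    [AddCommGroup M] [Module K M] [Module R M] [IsScalarTower R K M] {n : ℕ} {x v : Fin n → M}
    (hv : ∀ i, v i ∈ Submodule.span R (Set.range x)) :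
    ExteriorAlgebra.ιMulti K n v ∈ Submodule.span R {ExteriorAlgebra.ιMulti K n x} := by
  classical
  choose c hc using fun i => (Submodule.mem_span_range_iff_exists_fun R).mp (hv i)
  have hv' : v = fun i => ∑ j, algebraMap R K (c i j) • x j := by
    funext i
    simp [← hc i]
  rw [hv', ← AlternatingMap.coe_multilinearMap, MultilinearMap.map_sum]
  refine Submodule.sum_mem _ fun σ _ => ?_
  rw [MultilinearMap.map_smul_univ, ← map_prod, algebraMap_smul]
  refine Submodule.smul_mem _ _ ?_
  -- In the multilinear expansion an injective `σ` is a permutation and contributes a sign; any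
  -- other term repeats a vector and vanishes.
  by_cases hσ : Function.Injective σ
  · have := AlternatingMap.map_perm (ExteriorAlgebra.ιMulti K n) x
      (Equiv.ofBijective σ (Finite.injective_iff_bijective.mp hσ))
    rw [AlternatingMap.coe_multilinearMap]
    refine (congrArg (· ∈ _) this).mpr ?_
    rcases Int.units_eq_one_or
      (Equiv.Perm.sign (Equiv.ofBijective σ (Finite.injective_iff_bijective.mp hσ))) with h | h
    · rw [h, one_smul]
      exact Submodule.mem_span_singleton_self _
    · rw [h, Units.neg_smul, one_smul]
      exact Submodule.neg_mem _ (Submodule.mem_span_singleton_self _)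
  · obtain ⟨i, j, hij, hne⟩ : ∃ i j, σ i = σ j ∧ i ≠ j := by
      simpa [Function.Injective] using hσ
    have h0 : ExteriorAlgebra.ιMulti K n (fun i => x (σ i)) = 0 :=
      AlternatingMap.map_eq_zero_of_eq _ _ (congrArg x hij) hne
    rw [AlternatingMap.coe_multilinearMap, h0]
    exact Submodule.zero_mem _

/-- The determinant with respect to `b` factors through the exterior power and takes the value `1`
on `b`. -/
theorem ιMulti_basis_ne_zero {K M : Type*} [Field K] [AddCommGroup M] [Module K M] {n : ℕ}
    (b : Module.Basis (Fin n) K M) : ExteriorAlgebra.ιMulti K n b ≠ 0 := by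
  intro h
  have h1 : exteriorPower.ιMulti K n b = 0 := Subtype.ext h
  have h2 := exteriorPower.alternatingMapLinearEquiv_apply_ιMulti b.det b
  rw [h1, map_zero, b.det_self] at h2
  exact zero_ne_one h2

theorem ιMulti_ne_zero_of_span_eq_top {K M : Type*} [Field K] [AddCommGroup M] [Module K M] {n : ℕ}
    (hn : Module.finrank K M = n) {x : Fin n → M} (hx : Submodule.span K (Set.range x) = ⊤) :
    ExteriorAlgebra.ιMulti K n x ≠ 0 := by
  have := ιMulti_basis_ne_zero
    (basisOfTopLeSpanOfCardEqFinrank x hx.ge (by simp [hn]))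
  simpa using this

theorem exists_eq_smul_ιMulti {K M : Type*} [Field K] [AddCommGroup M] [Module K M] {n : ℕ}
    {x : Fin n → M} (hx : Submodule.span K (Set.range x) = ⊤)
    {ω : ExteriorAlgebra K M} (hω : ω ∈ ⋀[K]^n M) : ∃ c : K, ω = c • ExteriorAlgebra.ιMulti K n x := by
  rw [← exteriorPower.ιMulti_span_fixedDegree] at hω
  have h : Submodule.span K (Set.range (ExteriorAlgebra.ιMulti K n (M := M))) ≤
      Submodule.span K {ExteriorAlgebra.ιMulti K n x} := by
    rw [Submodule.span_le]
    rintro _ ⟨v, rfl⟩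
    exact ιMulti_mem_span_singleton fun i => hx ▸ Submodule.mem_top
  obtain ⟨c, hc⟩ := Submodule.mem_span_singleton.mp (h hω)
  exact ⟨c, hc.symm⟩

noncomputable section

/-- The order of an element of the fraction field of a discrete valuation ring. -/
def dvrOrd (R : Type*) {K : Type*} [CommRing R] [IsDomain R] [IsDiscreteValuationRing R] [Field K]
    [Algebra R K] [IsFractionRing R K] (f : K) : ℤ :=
  WithZero.log (Ring.ordFrac R f)

section dvrOrd

variable {R K : Type*} [CommRing R] [IsDomain R] [IsDiscreteValuationRing R] [Field K]
    [Algebra R K] [IsFractionRing R K]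

/-- The order of `0` is the default value `0`, so additivity needs nonzero factors. -/
theorem dvrOrd_mul {f g : K} (hf : f ≠ 0) (hg : g ≠ 0) :
    dvrOrd R (f * g) = dvrOrd R f + dvrOrd R g := by
  simp [dvrOrd, WithZero.log_mul, hf, hg]

theorem dvrOrd_inv (f : K) : dvrOrd R f⁻¹ = - dvrOrd R f := by
  simp [dvrOrd]

theorem dvrOrd_pow (f : K) (n : ℕ) : dvrOrd R (f ^ n) = n * dvrOrd R f := by
  simp [dvrOrd]

theorem dvrOrd_zpow (f : K) (n : ℤ) : dvrOrd R (f ^ n) = n * dvrOrd R f := by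
  simp [dvrOrd]

theorem dvrOrd_irreducible {ϖ : R} (h : Irreducible ϖ) : dvrOrd R (algebraMap R K ϖ) = 1 := by
  simp [dvrOrd, Ring.ordFrac_irreducible h]

theorem dvrOrd_nonneg_iff {f : K} (hf : f ≠ 0) :
    0 ≤ dvrOrd R f ↔ f ∈ Set.range (algebraMap R K) := by
  have h0 : Ring.ordFrac R f ≠ 0 := by simpa using hf
  constructor
  · intro h
    obtain ⟨r, hr⟩ := IsDiscreteValuationRing.exists_lift_of_le_one (A := R) (K := K) (x := f) (by
      -- `Ring.ordFrac` is inverse to the multiplicative valuation, so a nonnegative order means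
      -- valuation at most one.
      rw [dvrOrd, Ring.ordFrac_eq_valuation_inv, WithZero.log_inv] at h
      rw [Ring.ordFrac_eq_valuation_inv, ne_eq, inv_eq_zero] at h0
      rw [← WithZero.log_le_log h0 one_ne_zero, WithZero.log_one]
      linarith)
    exact ⟨r, hr⟩
  · rintro ⟨r, rfl⟩
    have hr : r ≠ 0 := by rintro rfl; simp at hf
    have := Ring.ordFrac_ge_one_of_ne_zero (K := K) hr
    rw [← WithZero.log_le_log one_ne_zero h0, WithZero.log_one] at this
    exact this

theorem dvrOrd_eq_zero_iff {f : K} (hf : f ≠ 0) :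
    dvrOrd R f = 0 ↔ ∃ r : R, IsUnit r ∧ algebraMap R K r = f := by
  constructor
  · intro h
    obtain ⟨r, rfl⟩ := (dvrOrd_nonneg_iff hf).mp h.ge
    obtain ⟨s, hs⟩ := (dvrOrd_nonneg_iff (R := R) (inv_ne_zero hf)).mp (by rw [dvrOrd_inv, h]; simp)
    refine ⟨r, IsUnit.of_mul_eq_one s (IsFractionRing.injective R K ?_), rfl⟩
    rw [map_mul, hs, map_one, mul_inv_cancel₀ hf]
  · rintro ⟨r, hr, rfl⟩
    simp [dvrOrd, Ring.ordFrac_of_isUnit hr]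

end dvrOrd

end

end

/-! ### Pull-back of top forms and the Riemann–Hurwitz inequality. -/

section

open IsLocalRing

noncomputable section

section formPullback

variable {k A B C : Type u} [CommRing k] [CommRing A] [CommRing B] [CommRing C] [Algebra k A]
    [Algebra k B] [Algebra k C]

theorem formPullback_smul (φ : A →ₐ[k] B) (c : A)
    (ω : ExteriorAlgebra A (KaehlerDifferential k A)) :
    formPullback φ (c • ω) = φ c • formPullback φ ω := by
  let : Algebra A B := φ.toRingHom.toAlgebra
  have : IsScalarTower k A B := IsScalarTower.of_algebraMap_eq fun r => (φ.commutes r).symm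
  simp only [formPullback, AlgHom.toRingHom_eq_coe, RingHom.coe_coe, map_smul]
  exact (algebraMap_smul B c _).symm

theorem formPullback_ιMulti_D (φ : A →ₐ[k] B) {n : ℕ} (x : Fin n → A) :
    formPullback φ (ExteriorAlgebra.ιMulti A n fun i => KaehlerDifferential.D k A (x i)) =
      ExteriorAlgebra.ιMulti B n fun i => KaehlerDifferential.D k B (φ (x i)) := by
  let : Algebra A B := φ.toRingHom.toAlgebra
  have : IsScalarTower k A B := IsScalarTower.of_algebraMap_eq fun r => (φ.commutes r).symm
  rw [ExteriorAlgebra.ιMulti_apply, ExteriorAlgebra.ιMulti_apply, map_list_prod, List.map_ofFn]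
  congr 2
  funext i
  simp only [formPullback, Function.comp_apply, AlgHom.toRingHom_eq_coe, RingHom.coe_coe,
    ExteriorAlgebra.lift_ι_apply]
  exact congrArg (ExteriorAlgebra.ι B) (KaehlerDifferential.map_D k k A B (x i))

end formPullback

section fields

variable {k K L : Type u} [Field k] [Field K] [Field L] [Algebra k K] [Algebra k L]

theorem exists_span_D_eq_top_of_field [Algebra.EssFiniteType k K] {n : ℕ}
    (hn : Module.finrank K (Ω[K⁄k]) = n) :
    ∃ x : Fin n → K, Submodule.span K (Set.range fun i => KaehlerDifferential.D k K (x i)) = ⊤ := by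
  have hspan := KaehlerDifferential.span_range_derivation k K
  obtain ⟨b, hb, hli, -⟩ := Submodule.exists_fun_fin_finrank_span_eq K
    (Set.range (KaehlerDifferential.D k K))
  have hbm : Module.finrank K (Submodule.span K (Set.range (KaehlerDifferential.D k K))) = n := by
    rw [hspan, finrank_top, hn]
  choose z hz using hb
  refine ⟨fun i => z (Fin.cast hbm.symm i), ?_⟩
  refine Eq.trans ?_ (hli.trans hspan)
  congr 1
  ext w
  simp only [Set.mem_range, hz]
  exact ⟨fun ⟨i, hi⟩ => ⟨_, hi⟩, fun ⟨i, hi⟩ => ⟨Fin.cast hbm i, hi⟩⟩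

/-- A separable (algebraic) extension of fields, given by a homomorphism. -/
abbrev AlgHom.IsSeparableExt (φ : K →ₐ[k] L) : Prop :=
  letI : Algebra K L := φ.toRingHom.toAlgebra
  Algebra.IsSeparable K L

/-- A separable algebraic extension is formally étale, so differentials are obtained by base change.
-/
theorem finrank_kaehlerDifferential_eq (φ : K →ₐ[k] L) (hφ : φ.IsSeparableExt) :
    Module.finrank L (Ω[L⁄k]) = Module.finrank K (Ω[K⁄k]) := by
  let : Algebra K L := φ.toRingHom.toAlgebra
  have : IsScalarTower k K L := IsScalarTower.of_algebraMap_eq fun r => (φ.commutes r).symm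
  have : Algebra.IsSeparable K L := hφ
  have : Algebra.FormallyEtale K L := Algebra.FormallyEtale.of_isSeparable K L
  rw [← (KaehlerDifferential.tensorKaehlerEquivOfFormallyEtale k K L).finrank_eq,
    Module.finrank_baseChange]

/-- Separability gives `Ω_{L/K} = 0`, so `L ⊗ Ω_{K/k}` surjects onto `Ω_{L/k}`. This is why the
pull-back of a nonzero top form stays nonzero. -/
theorem span_D_map_eq_top (φ : K →ₐ[k] L) (hφ : φ.IsSeparableExt) {ι : Type*} {x : ι → K}
    (hx : Submodule.span K (Set.range fun i => KaehlerDifferential.D k K (x i)) = ⊤) :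
    Submodule.span L (Set.range fun i => KaehlerDifferential.D k L (φ (x i))) = ⊤ := by
  let : Algebra K L := φ.toRingHom.toAlgebra
  have : IsScalarTower k K L := IsScalarTower.of_algebraMap_eq fun r => (φ.commutes r).symm
  have : Algebra.IsSeparable K L := hφ
  have : Algebra.FormallyUnramified K L := Algebra.FormallyUnramified.of_isSeparable K L
  have hsurj : LinearMap.range (KaehlerDifferential.mapBaseChange k K L) = ⊤ := by
    rw [KaehlerDifferential.range_mapBaseChange, eq_top_iff]
    intro z _
    exact Subsingleton.elim _ _
  rw [eq_top_iff, ← hsurj]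
  rintro _ ⟨z, rfl⟩
  induction z using TensorProduct.induction_on with
  | zero => simp
  | add a b ha hb => rw [map_add]; exact Submodule.add_mem _ ha hb
  | tmul l w =>
    rw [KaehlerDifferential.mapBaseChange_tmul]
    refine Submodule.smul_mem _ _ ?_
    have hw : w ∈ Submodule.span K (Set.range fun i => KaehlerDifferential.D k K (x i)) :=
      hx ▸ Submodule.mem_top
    induction hw using Submodule.span_induction with
    | mem w hw =>
      obtain ⟨i, rfl⟩ := hw
      refine Submodule.subset_span ⟨i, ?_⟩
      simp only [KaehlerDifferential.map_D]
      rfl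
    | zero => simp
    | add a b _ _ ha hb => rw [map_add]; exact Submodule.add_mem _ ha hb
    | smul c a _ ha =>
      rw [map_smul, ← algebraMap_smul L c]
      exact Submodule.smul_mem _ _ ha

/-- The pull-back of a nonzero form of top degree along a separable extension. -/
theorem formPullback_mem_and_ne_zero (φ : K →ₐ[k] L) (hφ : φ.IsSeparableExt)
    [Algebra.EssFiniteType k K] {n : ℕ} (hn : Module.finrank K (Ω[K⁄k]) = n)
    {ω : ExteriorAlgebra K (Ω[K⁄k])} (hω : ω ∈ ⋀[K]^n (Ω[K⁄k])) (h0 : ω ≠ 0) :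
    formPullback φ ω ∈ ⋀[L]^n (Ω[L⁄k]) ∧ formPullback φ ω ≠ 0 := by
  obtain ⟨x, hx⟩ := exists_span_D_eq_top_of_field hn
  obtain ⟨c, rfl⟩ := exists_eq_smul_ιMulti hx hω
  rw [formPullback_smul, formPullback_ιMulti_D]
  refine ⟨Submodule.smul_mem _ _ (ExteriorAlgebra.ιMulti_range L n (Set.mem_range_self _)), ?_⟩
  refine smul_ne_zero ?_ (ιMulti_ne_zero_of_span_eq_top
    ((finrank_kaehlerDifferential_eq φ hφ).trans hn) (span_D_map_eq_top φ hφ hx))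
  rw [ne_eq, map_eq_zero]
  rintro rfl
  simp at h0

theorem formPullback_comp_apply {M : Type u} [Field M] [Algebra k M] (φ : K →ₐ[k] L)
    (ψ : L →ₐ[k] M)
    [Algebra.EssFiniteType k K] {n : ℕ} (hn : Module.finrank K (Ω[K⁄k]) = n)
    {ω : ExteriorAlgebra K (Ω[K⁄k])} (hω : ω ∈ ⋀[K]^n (Ω[K⁄k])) :
    formPullback ψ (formPullback φ ω) = formPullback (ψ.comp φ) ω := by
  obtain ⟨x, hx⟩ := exists_span_D_eq_top_of_field hn
  obtain ⟨c, rfl⟩ := exists_eq_smul_ιMulti hx hω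
  simp only [formPullback_smul, formPullback_ιMulti_D, AlgHom.comp_apply]

end fields

section dvr

variable (k R : Type u) {K : Type u} [Field k] [CommRing R] [IsDomain R] [IsDiscreteValuationRing R]
  [Algebra k R] [Field K] [Algebra R K] [IsFractionRing R K] [Algebra k K] [IsScalarTower k R K]

/-- The forms of degree `n` that are regular on `R`. -/
def dvrRegularForms (n : ℕ) : Submodule R (ExteriorAlgebra K (KaehlerDifferential k K)) :=
  Submodule.span _ (Set.range fun a : Fin n → R =>
    ExteriorAlgebra.ιMulti K n fun i => KaehlerDifferential.D k K (algebraMap R K (a i)))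

/-- The order of a form of degree `n`. -/
def dvrOrdForm (n : ℕ) (ω : ExteriorAlgebra K (KaehlerDifferential k K)) : ℤ :=
  sSup {m : ℤ | ∃ f : K, f ≠ 0 ∧ dvrOrd R f = m ∧ f⁻¹ • ω ∈ dvrRegularForms k R n}

variable {k R}

/-- There are as many generators as the degree of the forms, so each `da₁ ∧ ⋯ ∧ daₙ` is a
determinant in `R` times the wedge of the generators. -/
theorem dvrRegularForms_eq_span {n : ℕ} {x : Fin n → R}
    (hx : Submodule.span R (Set.range fun i => KaehlerDifferential.D k R (x i)) = ⊤) :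
    dvrRegularForms k R n = Submodule.span R {ExteriorAlgebra.ιMulti K n
      fun i => KaehlerDifferential.D k K (algebraMap R K (x i))} := by
  apply le_antisymm
  · rw [dvrRegularForms, Submodule.span_le]
    rintro _ ⟨a, rfl⟩
    refine ιMulti_mem_span_singleton fun i => ?_
    have h : KaehlerDifferential.D k R (a i) ∈
        Submodule.span R (Set.range fun i => KaehlerDifferential.D k R (x i)) := hx ▸ Submodule.mem_top
    have h2 := Submodule.mem_map_of_mem (f := KaehlerDifferential.map k k R K) h
    rw [Submodule.map_span, ← Set.range_comp] at h2
    simpa [Function.comp_def] using h2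
  · rw [Submodule.span_singleton_le_iff_mem]
    exact Submodule.subset_span ⟨x, rfl⟩

/-- If the regular forms are generated by `η`, then `h • η` has the order of `h`. -/
theorem dvrOrdForm_smul {n : ℕ} {η : ExteriorAlgebra K (KaehlerDifferential k K)} (hη : η ≠ 0)
    (hreg : dvrRegularForms k R n = Submodule.span R {η}) {h : K} (hh : h ≠ 0) :
    (∀ f : K, f ≠ 0 → f⁻¹ • h • η ∈ dvrRegularForms k R n → dvrOrd R f ≤ dvrOrd R h) ∧
    dvrOrdForm k R n (h • η) = dvrOrd R h := by
  have key : ∀ f : K, f ≠ 0 → (f⁻¹ • h • η ∈ dvrRegularForms k R n ↔ dvrOrd R f ≤ dvrOrd R h) := by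
    intro f hf
    rw [hreg, Submodule.mem_span_singleton, smul_smul]
    have h1 : dvrOrd R (f⁻¹ * h) = - dvrOrd R f + dvrOrd R h := by
      rw [dvrOrd_mul (inv_ne_zero hf) hh, dvrOrd_inv]
    have h2 := dvrOrd_nonneg_iff (R := R) (mul_ne_zero (inv_ne_zero hf) hh)
    rw [h1] at h2
    constructor
    · rintro ⟨r, hr⟩
      have : 0 ≤ - dvrOrd R f + dvrOrd R h := h2.mpr ⟨r, by
        rw [← algebraMap_smul K r η] at hr
        exact smul_left_injective K hη hr⟩
      linarith
    · intro hle
      obtain ⟨r, hr⟩ := h2.mp (by linarith)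
      exact ⟨r, by rw [← hr, algebraMap_smul]⟩
  refine ⟨fun f hf => (key f hf).mp, ?_⟩
  -- The supremum is attained at `f = h`, so the default value of `sSup` on unbounded or empty sets
  -- of integers plays no role.
  refine IsGreatest.csSup_eq ⟨⟨h, hh, rfl, (key h hh).mpr le_rfl⟩, ?_⟩
  rintro _ ⟨f, hf, rfl, hfm⟩
  exact (key f hf).mp hfm

variable [PerfectField k] [Algebra.EssFiniteType k R]

/-- A local trivialization of the canonical sheaf: the order of a form becomes the order of its
coefficient. The uniformizer among the coordinates is what lets ramification be read off the
generator. -/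
theorem exists_generator (k R : Type u) {K : Type u} [Field k] [CommRing R] [IsDomain R]
    [IsDiscreteValuationRing R]
    [Algebra k R] [Field K] [Algebra R K] [IsFractionRing R K] [Algebra k K] [IsScalarTower k R K]
    [PerfectField k] [Algebra.EssFiniteType k R] {n : ℕ}
    (hn : Module.finrank K (Ω[K⁄k]) = n) :
    ∃ (x : Fin n → R) (i : Fin n), Irreducible (x i) ∧
      dvrRegularForms k R n = Submodule.span R {ExteriorAlgebra.ιMulti K n
        fun i => KaehlerDifferential.D k K (algebraMap R K (x i))} ∧
      (ExteriorAlgebra.ιMulti K n fun i => KaehlerDifferential.D k K (algebraMap R K (x i))) ≠ 0 ∧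
      ∀ ω ∈ ⋀[K]^n (Ω[K⁄k]), ω ≠ 0 → ∃ h : K, h ≠ 0 ∧ ω = h • ExteriorAlgebra.ιMulti K n
        fun i => KaehlerDifferential.D k K (algebraMap R K (x i)) := by
  subst hn
  obtain ⟨-, x, i, hi, hx⟩ := exists_span_D_eq_top k R K
  have hxK := span_D_algebraMap_eq_top K hx
  refine ⟨x, i, hi, dvrRegularForms_eq_span hx, ιMulti_ne_zero_of_span_eq_top rfl hxK, ?_⟩
  intro ω hω h0
  obtain ⟨c, hc⟩ := exists_eq_smul_ιMulti hxK hω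
  refine ⟨c, ?_, hc⟩
  rintro rfl
  simp [hc] at h0

theorem dvrOrdForm_smul_form {n : ℕ} (hn : Module.finrank K (Ω[K⁄k]) = n)
    {ω : ExteriorAlgebra K (Ω[K⁄k])} (hω : ω ∈ ⋀[K]^n (Ω[K⁄k])) (h0 : ω ≠ 0) {c : K} (hc : c ≠ 0) :
    dvrOrdForm k R n (c • ω) = dvrOrd R c + dvrOrdForm k R n ω := by
  obtain ⟨x, i, -, hreg, hη, hall⟩ := exists_generator k R hn
  obtain ⟨h, hh, rfl⟩ := hall ω hω h0
  rw [smul_smul, (dvrOrdForm_smul hη hreg hh).2, (dvrOrdForm_smul hη hreg (mul_ne_zero hc hh)).2,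
    dvrOrd_mul hc hh]

theorem le_dvrOrdForm {n : ℕ} (hn : Module.finrank K (Ω[K⁄k]) = n)
    {ω : ExteriorAlgebra K (Ω[K⁄k])} (hω : ω ∈ ⋀[K]^n (Ω[K⁄k])) (h0 : ω ≠ 0) {f : K} (hf : f ≠ 0)
    (hfω : f⁻¹ • ω ∈ dvrRegularForms k R n) :
    dvrOrd R f ≤ dvrOrdForm k R n ω := by
  obtain ⟨x, i, -, hreg, hη, hall⟩ := exists_generator k R hn
  obtain ⟨h, hh, rfl⟩ := hall ω hω h0
  have := dvrOrdForm_smul hη hreg hh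
  rw [this.2]
  exact this.1 f hf hfω

/-- The inequality of Riemann–Hurwitz type for an extension of discrete valuation rings of
ramification index `e`. -/
theorem mul_dvrOrdForm_add_one_le {R' L : Type u} [CommRing R'] [IsDomain R']
    [IsDiscreteValuationRing R'] [Algebra k R'] [Field L] [Algebra R' L] [IsFractionRing R' L]
    [Algebra k L] [IsScalarTower k R' L] [Algebra.EssFiniteType k R'] (φ : K →ₐ[k] L)
    (hφ : φ.IsSeparableExt) {e : ℕ} (he : 1 ≤ e)
    (hord : ∀ f : K, f ≠ 0 → dvrOrd R' (φ f) = e * dvrOrd R f) {n : ℕ}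
    (hn : Module.finrank K (Ω[K⁄k]) = n) {ω : ExteriorAlgebra K (Ω[K⁄k])}
    (hω : ω ∈ ⋀[K]^n (Ω[K⁄k])) (h0 : ω ≠ 0) :
    e * (dvrOrdForm k R n ω + 1) ≤ dvrOrdForm k R' n (formPullback φ ω) + 1 := by
  have : Algebra.EssFiniteType k K := essFiniteType_fractionRing k R K
  obtain ⟨hm, hne⟩ := formPullback_mem_and_ne_zero φ hφ hn hω h0
  obtain ⟨x, i, hi, hreg, hη, hall⟩ := exists_generator k R hn
  obtain ⟨h, hh, rfl⟩ := hall ω hω h0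
  have hφ0 : ∀ {f : K}, f ≠ 0 → φ f ≠ 0 := fun hf => (map_ne_zero φ).mpr hf
  have hint : ∀ r : R, ∃ r' : R', algebraMap R' L r' = φ (algebraMap R K r) := by
    intro r
    by_cases hr : r = 0
    · exact ⟨0, by simp [hr]⟩
    have hr' : algebraMap R K r ≠ 0 := by simpa using hr
    refine (dvrOrd_nonneg_iff (hφ0 hr')).mp ?_
    rw [hord _ hr']
    exact mul_nonneg (by positivity) ((dvrOrd_nonneg_iff hr').mpr ⟨r, rfl⟩)
  choose y hy using fun j => hint (x j)
  obtain ⟨s, hs⟩ := IsDiscreteValuationRing.exists_irreducible R'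
  have hyi : y i ≠ 0 := by
    intro h
    have := hy i
    rw [h, map_zero, eq_comm, map_eq_zero] at this
    exact hi.ne_zero (by simpa using this)
  obtain ⟨m, u, hu⟩ := IsDiscreteValuationRing.eq_unit_mul_pow_irreducible hyi hs
  have hs0 : algebraMap R' L s ≠ 0 := by simpa using hs.ne_zero
  -- `φ(xᵢ) = u s^m`, and comparing orders identifies the exponent with the ramification index.
  -- Below, `e` is written as `m + 1`, so `s ^ m` is the factor `s^(e-1)`.
  have hme : m = e := by
    have h1 := hord _ (show algebraMap R K (x i) ≠ 0 by simpa using hi.ne_zero)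
    have hu0 : algebraMap R' L (u : R') ≠ 0 := by simp
    rw [← hy i, hu, map_mul, map_pow, dvrOrd_mul hu0 (pow_ne_zero _ hs0), dvrOrd_pow,
      dvrOrd_irreducible hs, dvrOrd_irreducible hi,
      (dvrOrd_eq_zero_iff (R := R') hu0).mpr ⟨u, u.isUnit, rfl⟩] at h1
    simp at h1
    exact_mod_cast h1
  subst hme
  obtain ⟨m, rfl⟩ : ∃ l, m = l + 1 := ⟨m - 1, by omega⟩
  rw [(dvrOrdForm_smul hη hreg hh).2]
  -- Once the pulled-back form divided by `φ(h) s^(e-1)` is known to be regular, its order is at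
  -- least `e ord(h) + e - 1`, which is the claim.
  have hpow : φ h * algebraMap R' L s ^ m ≠ 0 := mul_ne_zero (hφ0 hh) (pow_ne_zero _ hs0)
  have hle := le_dvrOrdForm (R := R') ((finrank_kaehlerDifferential_eq φ hφ).trans hn) hm hne hpow ?_
  · rw [dvrOrd_mul (hφ0 hh) (pow_ne_zero _ hs0), hord _ hh, dvrOrd_pow, dvrOrd_irreducible hs] at hle
    push_cast at hle ⊢
    linarith
  rw [formPullback_smul, formPullback_ιMulti_D, smul_smul, mul_inv, mul_right_comm,
    inv_mul_cancel₀ (hφ0 hh), one_mul]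
  simp only [← hy]
  -- the `i`-th differential is divisible by `s ^ m`
  have hD : KaehlerDifferential.D k L (algebraMap R' L (y i)) = (algebraMap R' L s ^ m) •
      (algebraMap R' L s • KaehlerDifferential.D k L (algebraMap R' L (u : R')) +
        algebraMap R' L ((m + 1) * u) • KaehlerDifferential.D k L (algebraMap R' L s)) := by
    rw [hu, map_mul, Derivation.leibniz, map_pow, Derivation.leibniz_pow, add_comm]
    simp only [smul_add, smul_smul, map_mul, map_add, map_natCast, map_one,
      Nat.add_sub_cancel, ← Nat.cast_smul_eq_nsmul L]
    congr 2 <;> (push_cast; ring)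
  have hupd : (fun j => KaehlerDifferential.D k L (algebraMap R' L (y j))) =
      Function.update (fun j => KaehlerDifferential.D k L (algebraMap R' L (y j))) i
        (KaehlerDifferential.D k L (algebraMap R' L (y i))) := by simp
  have hmemupd : ∀ a : R', ExteriorAlgebra.ιMulti L n (Function.update
      (fun j => KaehlerDifferential.D k L (algebraMap R' L (y j))) i
      (KaehlerDifferential.D k L (algebraMap R' L a))) ∈ dvrRegularForms k R' n := by
    intro a
    refine Submodule.subset_span ⟨Function.update y i a, ?_⟩
    refine congrArg (ExteriorAlgebra.ιMulti L n) (funext fun j => ?_)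
    by_cases hj : j = i
    · subst hj; simp
    · simp [hj]
  rw [hupd, hD, AlternatingMap.map_update_smul, smul_smul, inv_mul_cancel₀ (pow_ne_zero _ hs0),
    one_smul, AlternatingMap.map_update_add,
    AlternatingMap.map_update_smul, AlternatingMap.map_update_smul, algebraMap_smul, algebraMap_smul]
  exact Submodule.add_mem _ (Submodule.smul_mem _ _ (hmemupd _)) (Submodule.smul_mem _ _ (hmemupd _))

end dvr

end

end

/-! ### Conductor primes of normal domains, and independent differentials. -/

section

open IsLocalRing

section Hartogs

/-- The class of `f` in `K` modulo the image of `A` is nonzero, so its annihilator lies in an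
associated prime, which is itself the annihilator of the class of some `c`. -/
theorem exists_prime_conductor {A K : Type*} [CommRing A] [IsNoetherianRing A] [Field K]
    [Algebra A K] {f : K} (hf : f ∉ Set.range (algebraMap A K)) :
    ∃ P : Ideal A, P.IsPrime ∧
      (∃ c : K, ∀ a, a ∈ P ↔ algebraMap A K a * c ∈ Set.range (algebraMap A K)) ∧
      ∀ a, algebraMap A K a * f ∈ Set.range (algebraMap A K) → a ∈ P := by
  let N : Submodule A K := LinearMap.range (Algebra.linearMap A K)
  have hN : ∀ (a : A) (c : K), a ∈ (⊥ : Submodule A (K ⧸ N)).colon {N.mkQ c} ↔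
      algebraMap A K a * c ∈ Set.range (algebraMap A K) := by
    intro a c
    rw [Submodule.mem_colon_singleton, Submodule.mem_bot, ← map_smul, Submodule.mkQ_apply,
      Submodule.Quotient.mk_eq_zero, Algebra.smul_def]
    rfl
  have hf0 : N.mkQ f ≠ 0 := by
    rw [ne_eq, Submodule.mkQ_apply, Submodule.Quotient.mk_eq_zero]
    exact hf
  obtain ⟨P, hP, hle⟩ := exists_le_isAssociatedPrime_of_isNoetherianRing A (N.mkQ f) hf0
  obtain ⟨hprime, x, rfl⟩ := isAssociatedPrime_iff.mp hP
  obtain ⟨c, rfl⟩ := N.mkQ_surjective x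
  exact ⟨_, hprime, ⟨c, fun a => hN a c⟩, fun a ha => hle ((hN a f).mpr ha)⟩

/-- A normal noetherian local domain whose maximal ideal is the conductor of an element of the
fraction field is a discrete valuation ring. -/
theorem isDiscreteValuationRing_of_conductor {B K : Type*} [CommRing B] [IsDomain B]
    [IsNoetherianRing B] [IsLocalRing B] [IsIntegrallyClosed B] [Field K] [Algebra B K]
    [IsFractionRing B K] {c : K} (hc : c ∉ Set.range (algebraMap B K))
    (hm : ∀ b ∈ maximalIdeal B, algebraMap B K b * c ∈ Set.range (algebraMap B K)) :
    IsDiscreteValuationRing B := by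
  have hnf : ¬ IsField B := by
    intro h
    exact hc ((IsFractionRing.surjective_iff_isField (R := B) (K := K)).mpr h c)
  refine ((IsDiscreteValuationRing.TFAE B hnf).out 0 4).mpr ?_
  -- If `c` maps the maximal ideal into itself, it is integral over `B` by Cayley–Hamilton and hence
  -- lies in `B`. Otherwise `b c` is a unit for some `b` in the maximal ideal, and `b` generates
  -- that ideal.
  by_cases h : ∀ b ∈ maximalIdeal B, ∃ b' ∈ maximalIdeal B, algebraMap B K b * c = algebraMap B K b'
  · exfalso
    refine hc (IsIntegrallyClosed.isIntegral_iff.mp (isIntegral_of_smul_mem_submodule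
      (Submodule.map (Algebra.linearMap B K) (maximalIdeal B)) ?_ ?_ c ?_))
    · intro h0
      rw [← le_bot_iff, Submodule.map_le_iff_le_comap, Submodule.comap_bot,
        LinearMap.ker_eq_bot.mpr (IsFractionRing.injective B K), le_bot_iff] at h0
      exact isField_iff_maximalIdeal_eq.not.mp hnf h0
    · exact (IsNoetherian.noetherian (maximalIdeal B)).map _
    · rintro _ ⟨b, hb, rfl⟩
      obtain ⟨b', hb', h1⟩ := h b hb
      exact ⟨b', hb', by simpa [mul_comm] using h1.symm⟩
  · push Not at h
    obtain ⟨b, hb, hb'⟩ := h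
    obtain ⟨u, hu⟩ := hm b hb
    have huu : IsUnit u := by
      by_contra hn
      exact hb' u hn hu.symm
    obtain ⟨u, rfl⟩ := huu
    refine ⟨b, le_antisymm (fun b₁ hb₁ => ?_) ?_⟩
    · obtain ⟨r, hr⟩ := hm b₁ hb₁
      refine Ideal.mem_span_singleton.mpr ⟨r * ↑u⁻¹, IsFractionRing.injective B K ?_⟩
      have hu' : algebraMap B K (u : B) * algebraMap B K (↑u⁻¹ : B) = 1 := by
        rw [← map_mul]; simp
      rw [map_mul, map_mul, hr]
      linear_combination (algebraMap B K b₁) * (algebraMap B K (↑u⁻¹ : B) * hu) - algebraMap B K b₁ * hu'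
    · rw [Ideal.submodule_span_eq, Ideal.span_singleton_le_iff_mem]
      exact hb

end Hartogs

section Greedy

/-- A family in `R` can be changed modulo the maximal ideal so that its differentials become
linearly independent. -/
theorem exists_linearIndependent_D {k R K : Type u} [Field k] [CommRing R] [IsDomain R]
    [IsLocalRing R] (hR : ¬ IsField R) [Algebra k R] [Field K] [Algebra R K] [IsFractionRing R K]
    [Algebra k K]
    [IsScalarTower k R K] [Algebra.EssFiniteType k K] (j : ℕ)
    (hj : j ≤ Module.finrank K (Ω[K⁄k])) (x : Fin j → R) :
    ∃ y : Fin j → R, (∀ i, y i - x i ∈ maximalIdeal R) ∧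
      LinearIndependent K fun i => KaehlerDifferential.D k K (algebraMap R K (y i)) := by
  induction j with
  | zero => exact ⟨x, fun i => i.elim0, linearIndependent_empty_type⟩
  | succ j ih =>
    obtain ⟨y, hy, hli⟩ := ih (by omega) (fun i => x i.castSucc)
    set W := Submodule.span K (Set.range fun i => KaehlerDifferential.D k K (algebraMap R K (y i)))
      with hW
    -- If no perturbation works, `dh ∈ W` for all `h` in the maximal ideal. Fixing `t ≠ 0` there, `t
    -- dr = d(t r) - r dt` lies in `W` for all `r`, so `W` is everything, although it is spanned by
    -- only `j` vectors.
    have hex : ∃ h ∈ maximalIdeal R,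
        KaehlerDifferential.D k K (algebraMap R K (x (Fin.last j) + h)) ∉ W := by
      by_contra! hcon
      have h0 : ∀ h ∈ maximalIdeal R, KaehlerDifferential.D k K (algebraMap R K h) ∈ W := by
        intro h hh
        have h1 := hcon h hh
        have h2 := hcon 0 (zero_mem _)
        rw [add_zero] at h2
        rw [map_add, map_add] at h1
        simpa using W.sub_mem h1 h2
      obtain ⟨t, htm, ht0⟩ := Submodule.exists_mem_ne_zero_of_ne_bot
        (isField_iff_maximalIdeal_eq.not.mp hR)
      have ht0' : algebraMap R K t ≠ 0 := by simpa using ht0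
      have h1 : ∀ r : R, KaehlerDifferential.D k K (algebraMap R K r) ∈ W := by
        intro r
        have := h0 (t * r) (Ideal.mul_mem_right _ _ htm)
        rw [map_mul, Derivation.leibniz] at this
        have h2 := W.sub_mem this (W.smul_mem (algebraMap R K r) (h0 t htm))
        rw [add_sub_cancel_right] at h2
        simpa only [smul_smul, inv_mul_cancel₀ ht0', one_smul] using W.smul_mem (algebraMap R K t)⁻¹ h2
      have h2 : W = ⊤ := by
        rw [eq_top_iff, ← span_D_algebraMap_eq_top (k := k) (R := R) K (x := id)
          (by simpa using KaehlerDifferential.span_range_derivation k R), Submodule.span_le]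
        rintro _ ⟨r, rfl⟩
        exact h1 r
      have h3 := finrank_range_le_card (R := K)
        fun i => KaehlerDifferential.D k K (algebraMap R K (y i))
      rw [Set.finrank, ← hW, h2, finrank_top, Fintype.card_fin] at h3
      omega
    obtain ⟨h, hh, hhW⟩ := hex
    refine ⟨Fin.snoc y (x (Fin.last j) + h), ?_, ?_⟩
    · intro i
      refine Fin.lastCases ?_ (fun i => ?_) i
      · simpa using hh
      · simpa using hy i
    · have := linearIndependent_finSnoc.mpr ⟨hli, hhW⟩
      convert this using 1
      funext i
      refine Fin.lastCases ?_ (fun i => ?_) i <;> simp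

end Greedy

end

/-! ### Divisorial valuation rings as local rings of finitely generated normal algebras. -/

section

open IsLocalRing

/-- Let `P` be a normal noetherian domain with fraction field `F`, and let `R` be a valuation ring
of a finite separable extension `K` of `F`, centred on a principal prime of `P`. Then `R` is a
local ring of the integral closure `C` of `P` in `K`. -/
theorem exists_fraction_of_integralClosure {P F R K : Type u} [CommRing P] [IsDomain P]
    [IsNoetherianRing P] [IsIntegrallyClosed P] [Field F] [Algebra P F] [IsFractionRing P F]
    [CommRing R] [IsDomain R] [ValuationRing R] [Field K] [Algebra R K] [IsFractionRing R K]
    [Algebra P R] [Algebra P K] [IsScalarTower P R K] [Algebra F K] [IsScalarTower P F K]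
    [FiniteDimensional F K] [Algebra.IsSeparable F K] {C : Type u} [CommRing C] [IsDomain C]
    [Algebra P C] [Algebra C K] [IsScalarTower P C K] [IsIntegralClosure C P K]
    [IsIntegrallyClosed C] {τ : P}
    (hP : ∀ a : P, a ≠ 0 → ∃ (j : ℕ) (b : P), a = τ ^ j * b ∧ IsUnit (algebraMap P R b))
    (i : C →ₐ[P] R) (hi : ∀ c : C, algebraMap R K (i c) = algebraMap C K c) (r : R) :
    ∃ c s : C, IsUnit (i s) ∧ r * i s = i c := by
  have hfin : Module.Finite P C := IsIntegralClosure.finite P F K C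
  have hnoe : IsNoetherianRing C := IsNoetherianRing.of_finite P C
  have hfrac : IsFractionRing C K := IsIntegralClosure.isFractionRing_of_finite_extension P F K C
  have : Algebra.IsIntegral P C := IsIntegralClosure.isIntegral_algebra P K
  let p : Ideal C := (maximalIdeal R).comap i
  have hp : p.IsPrime := Ideal.comap_isPrime _ _
  have hmem : ∀ c : C, c ∈ p ↔ ¬ IsUnit (i c) := fun c => Iff.rfl
  have hiP : ∀ a : P, i (algebraMap P C a) = algebraMap P R a := fun a => i.commutes a
  let Cp := Localization.AtPrime p
  -- `Cp` is noetherian and normal, so it is enough that its only nonzero prime is the maximal one.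
  have hCp : ValuationRing Cp := by
    have : IsNoetherianRing Cp := IsLocalization.isNoetherianRing p.primeCompl Cp hnoe
    have : IsIntegrallyClosed Cp :=
      isIntegrallyClosed_of_isLocalization Cp p.primeCompl p.primeCompl_le_nonZeroDivisors
    have htfae : ValuationRing Cp ↔
        IsIntegrallyClosed Cp ∧ ∀ P : Ideal Cp, P ≠ ⊥ → P.IsPrime → P = maximalIdeal Cp :=
      (tfae_of_isNoetherianRing_of_isLocalRing_of_isDomain Cp).out 1 3
    refine htfae.mpr ⟨this, ?_⟩
    intro Q hQ hQp
    set q : Ideal C := Q.comap (algebraMap C Cp) with hq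
    have hqp : q.IsPrime := Ideal.comap_isPrime _ _
    have hqle : q ≤ p := fun c hc =>
      (IsLocalization.AtPrime.to_map_mem_maximal_iff Cp p c).mp (le_maximalIdeal hQp.ne_top hc)
    have hQq : q.map (algebraMap C Cp) = Q := IsLocalization.map_under p.primeCompl Cp Q
    have hq0 : q ≠ ⊥ := by
      intro h
      rw [h, Ideal.map_bot] at hQq
      exact hQ hQq.symm
    have hcomap : q.comap (algebraMap P C) ≠ ⊥ := Ideal.IsIntegral.comap_ne_bot P hq0
    -- By integrality `q` contracts to a nonzero ideal of `P`. A nonzero element there is `τ^j b`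
    -- with `b` outside `p`, which forces `τ ∈ q`.
    have hτq : algebraMap P C τ ∈ q := by
      obtain ⟨a, ha, ha0⟩ := Submodule.exists_mem_ne_zero_of_ne_bot hcomap
      obtain ⟨j, b, rfl, hb⟩ := hP a ha0
      have ha' : algebraMap P C (τ ^ j * b) ∈ q := ha
      rw [map_mul, map_pow] at ha'
      rcases hqp.mem_or_mem ha' with h | h
      · exact hqp.mem_of_pow_mem _ h
      · exact absurd (hqle h) (by rw [hmem, hiP]; simpa using hb)
    have hqeq : q = p := by
      refine le_antisymm hqle fun c hc => ?_
      by_contra hcq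
      -- Incomparability: a strict inclusion `q < p` would stay strict in `P`, but every element of
      -- `P` lying in `p` is a multiple of `τ`, hence in `q`.
      have hlt := Ideal.comap_lt_comap_of_integral_mem_sdiff (R := P) hqle ⟨hc, hcq⟩
        (Algebra.IsIntegral.isIntegral c)
      refine hlt.not_ge fun a ha => ?_
      by_cases ha0 : a = 0
      · rw [ha0]; exact zero_mem _
      obtain ⟨j, b, rfl, hb⟩ := hP a ha0
      rcases j with _ | j
      · have : ¬ IsUnit (i (algebraMap P C (τ ^ 0 * b))) := ha
        rw [hiP, pow_zero, one_mul] at this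
        exact absurd hb this
      · change algebraMap P C (τ ^ (j + 1) * b) ∈ q
        rw [map_mul, pow_succ, map_mul]
        exact Ideal.mul_mem_right _ _ (Ideal.mul_mem_left _ _ hτq)
    rw [← hQq, hqeq, Localization.AtPrime.map_eq_maximalIdeal]
  by_cases hr : r = 0
  · exact ⟨0, 1, by simp, by simp [hr]⟩
  obtain ⟨a, b, hb, hab⟩ := IsFractionRing.div_surjective (A := C) (algebraMap R K r)
  have hb0 : i b ≠ 0 := by
    intro h
    have := hi b
    rw [h, map_zero] at this
    exact nonZeroDivisors.ne_zero hb (IsFractionRing.injective C K (by rw [← this, map_zero]))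
  have hinj : ∀ {c d : R}, algebraMap R K c = algebraMap R K d → c = d :=
    fun h => IsFractionRing.injective R K h
  have hrab : r * i b = i a := by
    apply hinj
    rw [map_mul, hi, hi, ← hab]
    exact div_mul_cancel₀ _ (by rw [← hi]; simpa using hb0)
  have hsurj : ∀ z : Cp, ∃ c s : C, s ∉ p ∧ z * algebraMap C Cp s = algebraMap C Cp c := by
    intro z
    obtain ⟨⟨c, s⟩, hcs⟩ := IsLocalization.surj p.primeCompl z
    exact ⟨c, s, s.2, hcs⟩
  have hinjC : Function.Injective (algebraMap C Cp) :=
    IsLocalization.injective Cp p.primeCompl_le_nonZeroDivisors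
  rcases (ValuationRing.iff_dvd_total.mp hCp).total (algebraMap C Cp b) (algebraMap C Cp a) with
    ⟨z, hz⟩ | ⟨z, hz⟩
  · obtain ⟨c, s, hs, hzs⟩ := hsurj z
    refine ⟨c, s, by simpa [hmem] using hs, ?_⟩
    have h1 : a * s = b * c := hinjC (by rw [map_mul, map_mul, hz, mul_assoc, hzs])
    have h2 := congrArg i h1
    rw [map_mul, map_mul, ← hrab] at h2
    exact mul_left_cancel₀ hb0 (by linear_combination h2)
  -- Here the inverse of `r` is the fraction `c / s`. As `r ∈ R` and `r i(c) = i(s)` is a unit,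
  -- `i(c)` is a unit too, and `s / c` is the required fraction.
  · obtain ⟨c, s, hs, hzs⟩ := hsurj z
    have h1 : b * s = a * c := hinjC (by rw [map_mul, map_mul, hz, mul_assoc, hzs])
    have h2 := congrArg i h1
    rw [map_mul, map_mul, ← hrab] at h2
    have h3 : r * i c = i s := mul_left_cancel₀ hb0 (by linear_combination -h2)
    have hs' : IsUnit (i s) := by simpa [hmem] using hs
    exact ⟨s, c, isUnit_of_mul_isUnit_right (h3 ▸ hs'), h3⟩

/-- Every nonzero value of a polynomial at `t` is a power of `t` times a unit. -/
theorem exists_pow_mul_unit {S R : Type*} [CommRing S] [CommRing R] [IsLocalRing R]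
    [Algebra S R] (hS : ∀ a : S, a ≠ 0 → IsUnit (algebraMap S R a)) {t : R} (ht : ¬ IsUnit t)
    {p : Polynomial S} (hp : p ≠ 0) :
    ∃ (j : ℕ) (q : Polynomial S), p = Polynomial.X ^ j * q ∧ IsUnit (Polynomial.aeval t q) := by
  obtain ⟨q, hq, hq'⟩ := Polynomial.exists_eq_pow_rootMultiplicity_mul_and_not_dvd p hp 0
  rw [map_zero, sub_zero] at hq hq'
  refine ⟨_, q, hq, ?_⟩
  have h2 : q.coeff 0 ≠ 0 := fun h => hq' (Polynomial.X_dvd_iff.mpr h)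
  by_contra hu
  rw [← Polynomial.divX_mul_X_add q] at hu
  simp only [map_add, map_mul, Polynomial.aeval_X, Polynomial.aeval_C] at hu
  have h3 := Ideal.sub_mem (maximalIdeal R) hu
    (Ideal.mul_mem_left _ (Polynomial.aeval t q.divX) ht)
  rw [add_sub_cancel_left] at h3
  exact h3 (hS _ h2)

/-- If every element of `R` is a fraction of elements of the normal finitely generated `k`-algebra
`C` whose denominator is a unit of `R`, then `C` has a localization with the same properties that
contains a given finite subset of `R`. -/
theorem exists_localization_of_fractions {k R C : Type u} [Field k] [CommRing R] [IsDomain R]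
    [Algebra k R] [CommRing C] [IsDomain C] [Algebra k C] [IsIntegrallyClosed C]
    (hft : Algebra.FiniteType k C) (i : C →ₐ[k] R) (hiinj : Function.Injective i)
    (hfrac : ∀ r : R, ∃ c s : C, IsUnit (i s) ∧ r * i s = i c) (S : Finset R) :
    ∃ (B : Type u) (_ : CommRing B) (_ : IsDomain B) (_ : Algebra k B) (j : B →ₐ[k] R),
      Function.Injective j ∧ Algebra.FiniteType k B ∧ IsIntegrallyClosed B ∧
      (∀ a ∈ S, a ∈ Set.range j) ∧ ∀ r : R, ∃ b s : B, IsUnit (j s) ∧ r * j s = j b := by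
  classical
  choose c s hs hcs using hfrac
  -- Inverting the product of the denominators of the elements of `S` brings them all into the
  -- localization; it is a unit of `R`, so the map to `R` extends.
  let σ : C := ∏ a ∈ S, s a
  have hσ : IsUnit (i σ) := by
    rw [map_prod]
    exact IsUnit.prod_iff.mpr fun a _ => hs a
  have hσ0 : σ ≠ 0 := by
    intro h
    rw [h, map_zero] at hσ
    exact not_isUnit_zero hσ
  have hle : Submonoid.powers σ ≤ nonZeroDivisors C :=
    powers_le_nonZeroDivisors_of_noZeroDivisors hσ0
  let B := Localization.Away σ
  let j : B →ₐ[k] R := IsLocalization.liftAlgHom (M := Submonoid.powers σ) (f := i) (by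
    rintro ⟨_, m, rfl⟩
    exact (map_pow i σ m).symm ▸ hσ.pow m)
  have hj : ∀ c : C, j (algebraMap C B c) = i c := fun c => IsLocalization.lift_eq _ c
  have hBdom : IsDomain B := IsLocalization.isDomain_localization hle
  refine ⟨B, inferInstance, hBdom, inferInstance, j, ?_, ?_, ?_, ?_, ?_⟩
  · refine (injective_iff_map_eq_zero _).mpr fun b hb => ?_
    obtain ⟨⟨d, m⟩, hd⟩ := IsLocalization.surj (Submonoid.powers σ) b
    have h1 := congrArg j hd
    rw [map_mul, hb, zero_mul, hj] at h1
    have h2 : d = 0 := hiinj (by rw [← h1, map_zero])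
    simp only [h2, map_zero] at hd
    exact (IsLocalization.map_units B m).mul_left_eq_zero.mp hd
  · have h2 : Algebra.FiniteType C B := IsLocalization.finiteType_of_monoid_fg (Submonoid.powers σ) B
    exact Algebra.FiniteType.trans hft h2
  · exact isIntegrallyClosed_of_isLocalization B (Submonoid.powers σ) hle
  · intro a ha
    obtain ⟨d, hd⟩ : s a ∣ σ := Finset.dvd_prod_of_mem s ha
    refine ⟨IsLocalization.mk' B (c a * d) ⟨σ, Submonoid.mem_powers σ⟩, ?_⟩
    have h1 := congrArg j (IsLocalization.mk'_spec B (c a * d) ⟨σ, Submonoid.mem_powers σ⟩)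
    rw [map_mul, hj, hj] at h1
    refine hσ.mul_left_injective ?_
    change _ * i σ = a * i σ
    rw [h1, map_mul, ← hcs a, mul_assoc, ← map_mul, ← hd]
  · intro r
    exact ⟨algebraMap C B (c r), algebraMap C B (s r), by rw [hj]; exact hs r, by
      rw [hj, hj, hcs]⟩

/-- A valuation ring `R` of a finitely generated extension `K` of `k` with `dim Ω_{K/k} = n + 1`
whose residue field contains `n` algebraically independent elements is a local ring of a normal
finitely generated `k`-algebra, which may be chosen to contain any given finite subset of `R`. -/
theorem exists_finiteType_model {k R K : Type u} [Field k] [CommRing R] [IsDomain R]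
    [ValuationRing R] (hR : ¬ IsField R) [Algebra k R] [Field K] [Algebra R K] [IsFractionRing R K]
    [Algebra k K] [IsScalarTower k R K] [Algebra.EssFiniteType k K] {n : ℕ}
    (hn : Module.finrank K (Ω[K⁄k]) = n + 1) (x : Fin n → R)
    (hx : AlgebraicIndependent k fun i => residue R (x i)) (S : Finset R) :
    ∃ (B : Type u) (_ : CommRing B) (_ : IsDomain B) (_ : Algebra k B) (j : B →ₐ[k] R),
      Function.Injective j ∧ Algebra.FiniteType k B ∧ IsIntegrallyClosed B ∧
      (∀ a ∈ S, a ∈ Set.range j) ∧ ∀ r : R, ∃ b s : B, IsUnit (j s) ∧ r * j s = j b := by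
  classical
  -- The first `n` members keep their residues. The last is a perturbation of `0`, so it is an
  -- element `t` of the maximal ideal; it is nonzero since `dt ≠ 0`, but need not be a uniformizer.
  obtain ⟨y, hy, hli⟩ := exists_linearIndependent_D (k := k) (K := K) hR (n + 1) hn.ge
    (Fin.snoc x 0)
  let x' : Fin n → R := fun i => y i.castSucc
  let t : R := y (Fin.last n)
  have htm : ¬ IsUnit t := by
    have := hy (Fin.last n)
    rwa [Fin.snoc_last, sub_zero] at this
  have hx' : ∀ P : MvPolynomial (Fin n) k, P ≠ 0 → IsUnit (MvPolynomial.aeval x' P) := by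
    intro P hP
    have hres : ∀ i, residue R (x' i) = residue R (x i) := by
      intro i
      have := hy i.castSucc
      rw [Fin.snoc_castSucc] at this
      exact (Ideal.Quotient.eq.mpr this)
    have h : residue R (MvPolynomial.aeval x' P) =
        MvPolynomial.aeval (fun i => residue R (x i)) P := by
      simp only [← hres]
      exact MvPolynomial.comp_aeval_apply x' (IsScalarTower.toAlgHom k R (ResidueField R)) P
    by_contra hu
    exact hP ((injective_iff_map_eq_zero _).mp hx P (h ▸ (residue_eq_zero_iff _).mpr hu))
  have ht0 : t ≠ 0 := by
    intro h
    have := hli.ne_zero (Fin.last n)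
    rw [show y (Fin.last n) = 0 from h] at this
    simp at this
  let S₁ := MvPolynomial (Fin n) k
  let : Algebra S₁ R := (MvPolynomial.aeval x').toRingHom.toAlgebra
  have hS₁ : ∀ a : S₁, a ≠ 0 → IsUnit (algebraMap S₁ R a) := hx'
  let P := Polynomial S₁
  let : Algebra P R := (Polynomial.aeval t : Polynomial S₁ →ₐ[S₁] R).toRingHom.toAlgebra
  have hPR : ∀ a : P, algebraMap P R a = Polynomial.aeval t a := fun _ => rfl
  have : IsScalarTower k S₁ R := IsScalarTower.of_algebraMap_eq fun r =>
    ((MvPolynomial.aeval x').commutes r).symm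
  have : IsScalarTower S₁ P R := IsScalarTower.of_algebraMap_eq fun r =>
    ((Polynomial.aeval t : Polynomial S₁ →ₐ[S₁] R).commutes r).symm
  have : IsScalarTower k P R := IsScalarTower.of_algebraMap_eq fun r => by
    rw [IsScalarTower.algebraMap_apply k S₁ P, ← IsScalarTower.algebraMap_apply S₁ P R,
      ← IsScalarTower.algebraMap_apply k S₁ R]
  let : Algebra P K := ((algebraMap R K).comp (algebraMap P R)).toAlgebra
  have : IsScalarTower P R K := IsScalarTower.of_algebraMap_eq fun _ => rfl
  have : IsScalarTower k P K := IsScalarTower.of_algebraMap_eq fun r => by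
    rw [IsScalarTower.algebraMap_apply P R K, ← IsScalarTower.algebraMap_apply k P R,
      ← IsScalarTower.algebraMap_apply k R K]
  have hP : ∀ a : P, a ≠ 0 → ∃ (j : ℕ) (b : P), a = Polynomial.X ^ j * b ∧
      IsUnit (algebraMap P R b) := fun a ha => exists_pow_mul_unit hS₁ htm ha
  have hinj : Function.Injective (algebraMap P K) := by
    refine (injective_iff_map_eq_zero _).mpr fun a ha => ?_
    by_contra h0
    obtain ⟨j, b, rfl, hb⟩ := hP a h0
    rw [IsScalarTower.algebraMap_apply P R K, map_eq_zero_iff _ (IsFractionRing.injective R K),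
      map_mul, map_pow, hPR Polynomial.X, Polynomial.aeval_X] at ha
    exact mul_ne_zero (pow_ne_zero _ ht0) hb.ne_zero ha
  have : FaithfulSMul P K := (faithfulSMul_iff_algebraMap_injective P K).mpr hinj
  let F := FractionRing P
  let : Algebra F K := FractionRing.liftAlgebra P K
  have : IsScalarTower P F K := FractionRing.isScalarTower_liftAlgebra P K
  have : IsScalarTower k F K := IsScalarTower.of_algebraMap_eq fun r => by
    rw [IsScalarTower.algebraMap_apply k P F, ← IsScalarTower.algebraMap_apply P F K,
      ← IsScalarTower.algebraMap_apply k P K]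
  have hyP : ∀ i, ∃ a : P, algebraMap P K a = algebraMap R K (y i) := by
    intro i
    refine Fin.lastCases ⟨Polynomial.X, ?_⟩ (fun i => ⟨Polynomial.C (MvPolynomial.X i), ?_⟩) i
    · rw [IsScalarTower.algebraMap_apply P R K, hPR, Polynomial.aeval_X]
    · rw [IsScalarTower.algebraMap_apply P R K, hPR, Polynomial.aeval_C]
      congr 1
      exact MvPolynomial.aeval_X _ _
  -- The differentials of the `yᵢ` form a basis of `Ω_{K/k}` and vanish in `Ω_{K/F}`, because `yᵢ ∈
  -- F`. So `Ω_{K/F} = 0`, which makes `K` finite separable over `F`.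
  have : Algebra.FormallyUnramified F K := by
    rw [Algebra.formallyUnramified_iff, ← not_nontrivial_iff_subsingleton]
    intro hnt
    have hspan : Submodule.span K (Set.range
        fun i => KaehlerDifferential.D k K (algebraMap R K (y i))) = ⊤ :=
      hli.span_eq_top_of_card_eq_finrank' (by simp [hn])
    obtain ⟨z, hz⟩ := exists_ne (0 : Ω[K⁄F])
    obtain ⟨w, rfl⟩ := KaehlerDifferential.map_surjective k F K z
    refine hz ?_
    have hw : w ∈ Submodule.span K (Set.range
        fun i => KaehlerDifferential.D k K (algebraMap R K (y i))) := hspan ▸ Submodule.mem_top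
    induction hw using Submodule.span_induction with
    | mem w hw =>
      obtain ⟨i, rfl⟩ := hw
      obtain ⟨a, ha⟩ := hyP i
      simp only [KaehlerDifferential.map_D, Algebra.algebraMap_self, RingHom.id_apply]
      rw [← ha, IsScalarTower.algebraMap_apply P F K, Derivation.map_algebraMap]
    | zero => simp
    | add a b _ _ ha hb =>
      rw [map_add]
      by_cases h1 : KaehlerDifferential.map k F K K a = 0
      · by_cases h2 : KaehlerDifferential.map k F K K b = 0
        · rw [h1, h2, add_zero]
        · exact absurd (hb h2) h2
      · exact absurd (ha h1) h1
    | smul c a _ ha =>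
      rw [map_smul]
      by_cases h1 : KaehlerDifferential.map k F K K a = 0
      · rw [h1, smul_zero]
      · rw [ha h1, smul_zero]
  have : Algebra.EssFiniteType F K := Algebra.EssFiniteType.of_comp k F K
  have : Algebra.IsSeparable F K := Algebra.FormallyUnramified.isSeparable F K
  have : FiniteDimensional F K := Algebra.FormallyUnramified.finite_of_free F K
  let C := integralClosure P K
  have hclosed : IsIntegrallyClosed C := integralClosure.isIntegrallyClosedOfFiniteExtension F
  have hfin : Module.Finite P C := IsIntegralClosure.finite P F K C
  -- A valuation ring is integrally closed, so it contains the integral closure of `P`.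
  have hex : ∀ c : C, ∃ r : R, algebraMap R K r = c := fun c =>
    IsIntegrallyClosed.isIntegral_iff.mp (c.2.tower_top (A := R))
  choose i₀ hi₀ using hex
  have hRinj := IsFractionRing.injective R K
  let i : C →ₐ[P] R :=
    { toFun := i₀
      map_one' := hRinj (by rw [hi₀]; simp)
      map_mul' := fun a b => hRinj (by simp [hi₀])
      map_zero' := hRinj (by rw [hi₀]; simp)
      map_add' := fun a b => hRinj (by simp [hi₀])
      commutes' := fun a => hRinj (by
        rw [hi₀, ← IsScalarTower.algebraMap_apply P R K]; rfl) }
  have hi : ∀ c : C, algebraMap R K (i c) = algebraMap C K c := hi₀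
  have hiinj : Function.Injective i := fun a b hab => by
    apply Subtype.ext
    rw [← hi₀ a, ← hi₀ b]
    exact congrArg _ hab
  have hfrac := exists_fraction_of_integralClosure (P := P) (F := F) (R := R) (K := K) (C := C)
    hP i hi
  have hft : Algebra.FiniteType k C := by
    have h1 : Algebra.FiniteType k P := inferInstance
    have h2 : Algebra.FiniteType P C := inferInstance
    exact Algebra.FiniteType.trans h1 h2
  let ik : C →ₐ[k] R := i.restrictScalars k
  have hfrac' : ∀ r : R, ∃ c s : C, IsUnit (ik s) ∧ r * ik s = ik c := hfrac
  exact exists_localization_of_fractions (k := k) (R := R) (C := C) (i := ik) hft hiinj hfrac' S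

end

/-! ### Restriction of a divisorial valuation to a subfield. -/

section

open IsLocalRing

/-- In a valuation ring, one member of a finite family divides all the others. -/
theorem ValuationRing.exists_forall_dvd {ι R : Type*} [CommRing R] [IsDomain R] [ValuationRing R]
    {s : Finset ι} (hs : s.Nonempty) (f : ι → R) : ∃ i ∈ s, ∀ j ∈ s, f i ∣ f j := by
  classical
  induction hs using Finset.Nonempty.cons_induction with
  | singleton a => exact ⟨a, by simp⟩
  | cons a s h hs ih =>
    obtain ⟨i, hi, hij⟩ := ih
    rcases ValuationRing.dvd_total (f i) (f a) with h | h
    · exact ⟨i, by simp [hi], by simpa [h] using hij⟩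
    · exact ⟨a, by simp, by simpa using fun j hj => h.trans (hij j hj)⟩

/-- The residue field extension of an algebraic local extension of valuation rings is
algebraic. -/
theorem isAlgebraic_residueField {R R' : Type*} [CommRing R] [IsDomain R] [ValuationRing R]
    [CommRing R'] [IsDomain R'] [IsLocalRing R'] [Algebra R R'] [IsLocalHom (algebraMap R R')]
    (hinj : Function.Injective (algebraMap R R')) [Algebra.IsAlgebraic R R'] :
    Algebra.IsAlgebraic (ResidueField R) (ResidueField R') := by
  refine ⟨fun w => ?_⟩
  obtain ⟨w, rfl⟩ := residue_surjective w
  obtain ⟨p, hp, hpw⟩ := Algebra.IsAlgebraic.isAlgebraic (R := R) w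
  -- Dividing an algebraic equation by a coefficient of least valuation gives one coefficient equal
  -- to `1`, so the equation stays nontrivial modulo the maximal ideal.
  obtain ⟨i, hi, hdvd⟩ := ValuationRing.exists_forall_dvd
    (Polynomial.support_nonempty.mpr hp) p.coeff
  have hi0 : p.coeff i ≠ 0 := Polynomial.mem_support_iff.mp hi
  obtain ⟨q, hq⟩ : Polynomial.C (p.coeff i) ∣ p := by
    refine (Polynomial.C_dvd_iff_dvd_coeff _ _).mpr fun j => ?_
    by_cases hj : p.coeff j = 0
    · exact hj ▸ dvd_zero _
    · exact hdvd j (Polynomial.mem_support_iff.mpr hj)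
  have hqi : q.coeff i = 1 := by
    have h := congrArg (fun r => r.coeff i) hq
    simp only [Polynomial.coeff_C_mul] at h
    exact mul_left_cancel₀ hi0 (by rw [← h, mul_one])
  have hqw : Polynomial.aeval w q = 0 := by
    rw [hq, map_mul, Polynomial.aeval_C] at hpw
    exact (mul_eq_zero.mp hpw).resolve_left
      ((map_ne_zero_iff _ hinj).mpr hi0)
  refine ⟨q.map (residue R), fun h => ?_, ?_⟩
  · have := congrArg (fun r => r.coeff i) h
    simp [hqi] at this
  · have h := congrArg (residue R') hqw
    rw [map_zero] at h
    rw [← h, Polynomial.aeval_def, Polynomial.aeval_def, Polynomial.eval₂_map, Polynomial.hom_eval₂]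
    rfl

/-- Let `R'` be a divisorial valuation ring of `L`, essentially of finite type over the perfect
field `k`, and let `R` be the valuation ring of the subfield `K` over which `L` is separable
algebraic obtained by intersecting with `R'`. Then `R` is a local ring of a normal finitely
generated `k`-algebra containing a given finite subset of `R`. -/
theorem exists_finiteType_model_of_dominates {k R K R' L : Type u} [Field k] [PerfectField k]
    [CommRing R] [IsDomain R] [ValuationRing R] [Algebra k R] [Field K] [Algebra R K]
    [IsFractionRing R K] [Algebra k K] [IsScalarTower k R K] [Algebra.EssFiniteType k K]
    [CommRing R'] [IsDomain R'] [IsDiscreteValuationRing R'] [Algebra k R']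
    [Algebra.EssFiniteType k R'] [Field L] [Algebra R' L] [IsFractionRing R' L] [Algebra k L]
    [IsScalarTower k R' L] (φ : K →ₐ[k] L) (hφ : φ.IsSeparableExt) (ρ : R →ₐ[k] R')
    (hρ : ∀ r, algebraMap R' L (ρ r) = φ (algebraMap R K r))
    (hR : ∀ f : K, φ f ∈ Set.range (algebraMap R' L) → f ∈ Set.range (algebraMap R K))
    (S : Finset R) :
    ¬ IsField R ∧
    ∃ (B : Type u) (_ : CommRing B) (_ : IsDomain B) (_ : Algebra k B) (j : B →ₐ[k] R),
      Function.Injective j ∧ Algebra.FiniteType k B ∧ IsIntegrallyClosed B ∧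
      (∀ a ∈ S, a ∈ Set.range j) ∧ ∀ r : R, ∃ b s : B, IsUnit (j s) ∧ r * j s = j b := by
  have hRinj := IsFractionRing.injective R K
  have hR'inj := IsFractionRing.injective R' L
  let : Algebra R R' := ρ.toRingHom.toAlgebra
  have hRR' : ∀ r, algebraMap R R' r = ρ r := fun _ => rfl
  let : Algebra K L := φ.toRingHom.toAlgebra
  have hKL : ∀ r, algebraMap K L r = φ r := fun _ => rfl
  have hsep : Algebra.IsSeparable K L := hφ
  let : Algebra R L := ((algebraMap K L).comp (algebraMap R K)).toAlgebra
  have : IsScalarTower R K L := IsScalarTower.of_algebraMap_eq fun _ => rfl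
  have : IsScalarTower R R' L := IsScalarTower.of_algebraMap_eq fun r => (hρ r).symm
  have : IsScalarTower k R R' := IsScalarTower.of_algebraMap_eq fun r => (ρ.commutes r).symm
  have hinj : Function.Injective (algebraMap R R') := fun a b hab => by
    apply hRinj
    apply φ.toRingHom.injective
    have := congrArg (algebraMap R' L) hab
    rwa [hRR', hRR', hρ, hρ] at this
  have halg : Algebra.IsAlgebraic R R' := by
    refine ⟨fun w => ?_⟩
    rw [← isAlgebraic_algebraMap_iff (A := L) hR'inj, IsFractionRing.isAlgebraic_iff R K L]
    exact Algebra.IsAlgebraic.isAlgebraic _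
  have hloc : IsLocalHom (algebraMap R R') := by
    refine ⟨fun a ha => ?_⟩
    obtain ⟨u, hu⟩ := ha
    have ha0 : algebraMap R K a ≠ 0 := by
      intro h
      have h0 : a = 0 := hRinj (by rw [h, map_zero])
      rw [h0, map_zero] at hu
      exact u.ne_zero hu
    obtain ⟨b, hb⟩ := hR (algebraMap R K a)⁻¹ ⟨(u⁻¹ : R'ˣ), by
      rw [map_inv₀, ← hρ, ← hRR', ← hu]
      refine eq_inv_of_mul_eq_one_left ?_
      rw [← map_mul, Units.inv_mul, map_one]⟩
    exact IsUnit.of_mul_eq_one b (hRinj (by rw [map_mul, hb, mul_inv_cancel₀ ha0, map_one]))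
  -- Over a field `R`, a uniformizer of `R'` would be transcendental, but `R'` is algebraic over
  -- `R`.
  have hnf : ¬ IsField R := by
    intro hf
    obtain ⟨t, ht⟩ := IsDiscreteValuationRing.exists_irreducible R'
    refine transcendental_of_forall_isUnit (A := R) (fun a ha => ?_) ht.ne_zero ht.not_isUnit
      (Algebra.IsAlgebraic.isAlgebraic t)
    obtain ⟨b, hb⟩ := hf.mul_inv_cancel ha
    exact (IsUnit.of_mul_eq_one b hb).map _
  refine ⟨hnf, ?_⟩
  have hκ : Algebra.IsAlgebraic (ResidueField R) (ResidueField R') := isAlgebraic_residueField hinj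
  -- The residue field of `R'` has transcendence degree `dim Ω_{L/k} - 1`. Passing to `R` changes
  -- neither side, since the residue extension is algebraic and `L/K` is separable. Thus `R` is
  -- divisorial, although it is not yet known to be noetherian.
  have h1 := (exists_span_D_eq_top k R' L).1
  have h2 : Algebra.trdeg k (ResidueField R) = Algebra.trdeg k (ResidueField R') := by
    rw [← trdeg_add_eq k (ResidueField R) (A := ResidueField R'),
      trdeg_eq_zero (R := ResidueField R), add_zero]
  rw [finrank_kaehlerDifferential_eq φ hφ, ← h2] at h1
  obtain ⟨n, hn⟩ : ∃ n : ℕ, Algebra.trdeg k (ResidueField R) = n := by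
    have : Algebra.trdeg k (ResidueField R) < Cardinal.aleph0 :=
      lt_of_le_of_lt (self_le_add_right _ 1) (h1 ▸ Cardinal.natCast_lt_aleph0)
    exact Cardinal.lt_aleph0.mp this
  rw [hn] at h1
  have hn' : Module.finrank K (Ω[K⁄k]) = n + 1 := by exact_mod_cast h1.symm
  obtain ⟨s, hs⟩ := exists_isTranscendenceBasis k (ResidueField R)
  have hcard : Cardinal.mk s = n := hs.cardinalMk_eq_trdeg.trans hn
  have : Finite s := Cardinal.lt_aleph0_iff_finite.mp (hcard ▸ Cardinal.natCast_lt_aleph0)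
  have hnc : Nat.card s = n := by
    rw [Nat.card, hcard, Cardinal.toNat_natCast]
  let eq : Fin n ≃ s := (Finite.equivFinOfCardEq hnc).symm
  choose x hx using fun i => residue_surjective (R := R) (eq i : ResidueField R)
  refine exists_finiteType_model hnf hn' x ?_ S
  have h3 : (fun i => residue R (x i)) = (fun z : s => (z : ResidueField R)) ∘ eq := by
    funext i
    exact hx i
  rw [h3]
  exact hs.1.comp _ eq.injective

/-- Let `R'` be a divisorial valuation ring of `L`, essentially of finite type over the perfect
field `k`, and let `φ : K → L` be a separable algebraic extension. Then `φ⁻¹(R')` is a local ring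
of a normal finitely generated `k`-subalgebra `B` of `K`, which may be chosen to contain any given
finite subset of `φ⁻¹(R')`. -/
theorem exists_finiteType_model_of_comap {k K R' L : Type u} [Field k] [PerfectField k]
    [Field K] [Algebra k K] [Algebra.EssFiniteType k K]
    [CommRing R'] [IsDomain R'] [IsDiscreteValuationRing R'] [Algebra k R']
    [Algebra.EssFiniteType k R'] [Field L] [Algebra R' L] [IsFractionRing R' L] [Algebra k L]
    [IsScalarTower k R' L] (φ : K →ₐ[k] L) (hφ : φ.IsSeparableExt) (S : Finset K)
    (hS : ∀ a ∈ S, φ a ∈ Set.range (algebraMap R' L)) :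
    (∃ f : K, f ≠ 0 ∧ φ f ∈ Set.range (algebraMap R' L) ∧
      φ f⁻¹ ∉ Set.range (algebraMap R' L)) ∧
    ∃ (B : Type u) (_ : CommRing B) (_ : IsDomain B) (_ : Algebra k B) (ι : B →ₐ[k] K)
      (ρ : B →ₐ[k] R'),
      Function.Injective ι ∧ Algebra.FiniteType k B ∧ IsIntegrallyClosed B ∧
      (∀ a ∈ S, a ∈ Set.range ι) ∧ (∀ b, algebraMap R' L (ρ b) = φ (ι b)) ∧
      ∀ f : K, φ f ∈ Set.range (algebraMap R' L) →
        ∃ b s : B, IsUnit (ρ s) ∧ f * ι s = ι b := by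
  classical
  have hR'inj := IsFractionRing.injective R' L
  let V : ValuationSubring K :=
    { (algebraMap R' L).range.comap φ.toRingHom with
      mem_or_inv_mem' := fun f => by
        rcases ValuationRing.isInteger_or_isInteger R' (φ f) with h | h
        · exact Or.inl h
        · right
          change φ f⁻¹ ∈ Set.range (algebraMap R' L)
          rw [map_inv₀]
          exact h }
  have hV : ∀ f : K, f ∈ V ↔ φ f ∈ Set.range (algebraMap R' L) := fun f => Iff.rfl
  let : Algebra k V := ((algebraMap k K).codRestrict V.toSubring fun a =>
    (hV _).mpr ⟨algebraMap k R' a, by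
      rw [← IsScalarTower.algebraMap_apply]
      exact (φ.commutes a).symm⟩).toAlgebra
  have : IsScalarTower k V K := IsScalarTower.of_algebraMap_eq fun _ => rfl
  choose ρ₀ hρ₀ using fun v : V => (hV v).mp v.2
  let ρ : V →ₐ[k] R' :=
    { toFun := ρ₀
      map_one' := hR'inj (by rw [hρ₀]; simp)
      map_mul' := fun a b => hR'inj (by simp [hρ₀])
      map_zero' := hR'inj (by rw [hρ₀]; simp)
      map_add' := fun a b => hR'inj (by simp [hρ₀])
      commutes' := fun a => hR'inj (by
        rw [hρ₀, ← IsScalarTower.algebraMap_apply k R' L, ← φ.commutes]; rfl) }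
  have hρ : ∀ v : V, algebraMap R' L (ρ v) = φ (algebraMap V K v) := hρ₀
  let T : Finset V := S.attach.image fun a => ⟨a.1, (hV _).mpr (hS a.1 a.2)⟩
  obtain ⟨hnf, B, i1, i2, i3, j, hj, hft, hcl, hSj, hfrac⟩ :=
    exists_finiteType_model_of_dominates (R := V) (K := K) (R' := R') (L := L) φ hφ ρ hρ
      (fun f hf => ⟨⟨f, (hV f).mpr hf⟩, rfl⟩) T
  refine ⟨?_, B, i1, i2, i3, (IsScalarTower.toAlgHom k V K).comp j, ρ.comp j, ?_, hft, hcl, ?_,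
    fun b => hρ (j b), ?_⟩
  · obtain ⟨v, hv0, hv⟩ := Ring.exists_not_isUnit_of_not_isField hnf
    refine ⟨v, by simpa using hv0, (hV v).mp v.2, fun h => hv ?_⟩
    exact IsUnit.of_mul_eq_one (⟨(v : K)⁻¹, (hV _).mpr h⟩ : V)
      (Subtype.ext (mul_inv_cancel₀ (by simpa using hv0)))
  · exact (IsFractionRing.injective V K).comp hj
  · intro a ha
    obtain ⟨b, hb⟩ := hSj ⟨a, hS a ha⟩ (Finset.mem_image.mpr ⟨⟨a, ha⟩, Finset.mem_attach _ _, rfl⟩)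
    exact ⟨b, congrArg Subtype.val hb⟩
  · intro f hf
    obtain ⟨b, s, hs, hbs⟩ := hfrac ⟨f, (hV f).mpr hf⟩
    exact ⟨b, s, hs.map ρ, congrArg Subtype.val hbs⟩

end

/-! ### Local rings of normal varieties. -/

noncomputable section

namespace NormalVariety

variable {k : Type u} [Field k]

instance stalkAlgebra (X : NormalVariety k) (x : X.toScheme) :
    Algebra k (X.toScheme.presheaf.stalk x) :=
  (X.scalars ≫ X.toScheme.presheaf.germ ⊤ x (TopologicalSpace.Opens.mem_top _)).hom.toAlgebra

instance isScalarTower_stalk (X : NormalVariety k) (x : X.toScheme) :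
    IsScalarTower k (X.toScheme.presheaf.stalk x) X.FunctionField := by
  refine IsScalarTower.of_algebraMap_eq' ?_
  change (X.scalars ≫ X.toScheme.presheaf.germ ⊤ (genericPoint X.toScheme) _).hom =
    ((X.scalars ≫ X.toScheme.presheaf.germ ⊤ x _) ≫ X.toScheme.presheaf.stalkSpecializes _).hom
  rw [Category.assoc, TopCat.Presheaf.germ_stalkSpecializes]

/-- The homomorphism `k → Γ(X, U)` given by the structure morphism. -/
def scalarsOn (X : NormalVariety k) (U : X.toScheme.Opens) :
    CommRingCat.of k ⟶ Γ(X.toScheme, U) :=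
  X.scalars ≫ X.toScheme.presheaf.map (homOfLE le_top).op

theorem scalarsOn_eq (X : NormalVariety k) (U : X.toScheme.Opens) :
    X.scalarsOn U = (Scheme.ΓSpecIso (CommRingCat.of k)).inv ≫ X.str.appLE ⊤ U le_top := by
  rw [scalarsOn, scalars, Category.assoc]
  rfl

theorem scalarsOn_germ (X : NormalVariety k) (U : X.toScheme.Opens) (x : X.toScheme) (hx : x ∈ U) :
    X.scalarsOn U ≫ X.toScheme.presheaf.germ U x hx =
      X.scalars ≫ X.toScheme.presheaf.germ ⊤ x (TopologicalSpace.Opens.mem_top _) := by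
  rw [scalarsOn, Category.assoc, TopCat.Presheaf.germ_res]

theorem finiteType_scalarsOn (X : NormalVariety k) {U : X.toScheme.Opens} (hU : IsAffineOpen U) :
    (X.scalarsOn U).hom.FiniteType := by
  have := X.locallyOfFiniteType
  have h := LocallyOfFiniteType.finiteType_appLE X.str (isAffineOpen_top _) hU le_top
  rw [scalarsOn_eq, CommRingCat.hom_comp]
  exact h.comp (RingHom.FiniteType.of_surjective _
    (ConcreteCategory.bijective_of_isIso (Scheme.ΓSpecIso (CommRingCat.of k)).inv).2)

instance essFiniteType_stalk (X : NormalVariety k) (x : X.toScheme) :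
    Algebra.EssFiniteType k (X.toScheme.presheaf.stalk x) := by
  obtain ⟨_, ⟨U, hU, rfl⟩, hxU, -⟩ :=
    X.toScheme.isBasis_affineOpens.exists_subset_of_mem_open (Set.mem_univ x) isOpen_univ
  let : Algebra k Γ(X.toScheme, U) := (X.scalarsOn U).hom.toAlgebra
  let := X.toScheme.presheaf.algebra_section_stalk ⟨x, hxU⟩
  have : IsScalarTower k Γ(X.toScheme, U) (X.toScheme.presheaf.stalk x) :=
    IsScalarTower.of_algebraMap_eq' (congrArg (·.hom) (X.scalarsOn_germ U x hxU)).symm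
  have hft : Algebra.FiniteType k Γ(X.toScheme, U) := X.finiteType_scalarsOn hU
  have hloc := hU.isLocalization_stalk ⟨x, hxU⟩
  have : Algebra.EssFiniteType Γ(X.toScheme, U) (X.toScheme.presheaf.stalk x) :=
    Algebra.EssFiniteType.of_isLocalization _ (hU.primeIdealOf ⟨x, hxU⟩).asIdeal.primeCompl
  exact Algebra.EssFiniteType.comp k Γ(X.toScheme, U) _

instance essFiniteType_functionField (X : NormalVariety k) :
    Algebra.EssFiniteType k X.FunctionField :=
  X.essFiniteType_stalk (genericPoint X.toScheme)

/-- The Krull dimension of the local ring is the coheight of the point, and a normal noetherian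
local domain of dimension one is a discrete valuation ring. -/
theorem isDiscreteValuationRing_stalk_iff (X : NormalVariety k) (x : X.toScheme) :
    IsDiscreteValuationRing (X.toScheme.presheaf.stalk x) ↔ Order.coheight x = 1 := by
  have hdim := ringKrullDim_stalk_eq_coheight x
  constructor
  · intro h
    rw [IsDiscreteValuationRing.ringKrullDim_eq_one] at hdim
    exact_mod_cast hdim.symm
  · intro h
    have h1 : Ring.KrullDimLE 1 (X.toScheme.presheaf.stalk x) := krullDimLE_of_coheight_le h.le
    have hnf : ¬ IsField (X.toScheme.presheaf.stalk x) := by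
      intro hf
      rw [ringKrullDim_eq_zero_of_isField hf, h] at hdim
      exact absurd hdim (by simp)
    have htfae : IsDiscreteValuationRing (X.toScheme.presheaf.stalk x) ↔
        IsIntegrallyClosed (X.toScheme.presheaf.stalk x) ∧
          ∃! P : Ideal (X.toScheme.presheaf.stalk x), P ≠ ⊥ ∧ P.IsPrime :=
      (IsDiscreteValuationRing.TFAE (X.toScheme.presheaf.stalk x) hnf).out 0 3
    refine htfae.mpr ⟨X.isIntegrallyClosed_stalk x, IsLocalRing.maximalIdeal _,
      ⟨IsLocalRing.isField_iff_maximalIdeal_eq.not.mp hnf, inferInstance⟩, ?_⟩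
    rintro P ⟨hP0, hP⟩
    exact IsLocalRing.eq_maximalIdeal (Ring.krullDimLE_one_iff_of_noZeroDivisors.mp h1 P hP0 hP)

instance (X : NormalVariety k) (E : X.PrimeDivisor) :
    IsDiscreteValuationRing (X.toScheme.presheaf.stalk E.1) :=
  (X.isDiscreteValuationRing_stalk_iff E.1).mpr E.2

theorem ord_eq_dvrOrd (X : NormalVariety k) (f : X.FunctionField) (E : X.PrimeDivisor) :
    X.ord f E = dvrOrd (X.toScheme.presheaf.stalk E.1) f := by
  rw [ord, Scheme.ord_eq_ordHom_of_coheight_eq_one E.2]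
  rfl

theorem ordForm_eq_dvrOrdForm (X : NormalVariety k) (ω : X.RationalForm) (E : X.PrimeDivisor) :
    X.ordForm ω E = dvrOrdForm k (X.toScheme.presheaf.stalk E.1) X.topDegree ω := by
  simp only [ordForm, ord_eq_dvrOrd]
  rfl

end NormalVariety

end

/-! ### Regularity in codimension one and pull-back of `ℚ`-Cartier divisors. -/

noncomputable section

/-- If an element `f` of the fraction field of a noetherian domain `A` does not lie in `A`, then
there is a prime ideal such that `f` does not lie in the local ring there, and such that this local
ring is a discrete valuation ring if it is normal. -/
theorem exists_prime_isDiscreteValuationRing {A K : Type u} [CommRing A] [IsNoetherianRing A]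
    [Field K] [Algebra A K] {f : K} (hf : f ∉ Set.range (algebraMap A K)) :
    ∃ (P : Ideal A) (_ : P.IsPrime), ∀ (R : Type u) [CommRing R] [IsDomain R] [IsLocalRing R]
      [IsNoetherianRing R] [IsIntegrallyClosed R] [Algebra A R] [Algebra R K] [IsFractionRing R K]
      [IsScalarTower A R K] [IsLocalization.AtPrime R P],
      IsDiscreteValuationRing R ∧ f ∉ Set.range (algebraMap R K) := by
  obtain ⟨P, hP, ⟨c, hc⟩, hPf⟩ := exists_prime_conductor hf
  refine ⟨P, hP, fun R _ _ _ _ _ _ _ _ _ _ => ?_⟩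
  have hA : ∀ a, algebraMap A K a = algebraMap R K (algebraMap A R a) :=
    IsScalarTower.algebraMap_apply A R K
  have key : ∀ g : K, g ∈ Set.range (algebraMap R K) →
      ∃ s : A, s ∉ P ∧ algebraMap A K s * g ∈ Set.range (algebraMap A K) := by
    rintro _ ⟨r, rfl⟩
    obtain ⟨⟨a, s⟩, has⟩ := IsLocalization.surj P.primeCompl r
    refine ⟨s, s.2, a, ?_⟩
    rw [hA, hA, ← has, map_mul, mul_comm]
  have hcr : c ∉ Set.range (algebraMap R K) := by
    intro hcr
    obtain ⟨s, hs, hsc⟩ := key c hcr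
    exact hs ((hc s).mpr hsc)
  refine ⟨isDiscreteValuationRing_of_conductor hcr fun m hm => ?_, fun hfr => ?_⟩
  · obtain ⟨⟨a, s⟩, has⟩ := IsLocalization.surj P.primeCompl m
    have haP : a ∈ P := by
      rw [← IsLocalization.AtPrime.to_map_mem_maximal_iff R P]
      exact has ▸ Ideal.mul_mem_right _ _ hm
    obtain ⟨b, hb⟩ := (hc a).mp haP
    obtain ⟨u, hu⟩ := IsLocalization.map_units R s
    refine ⟨algebraMap _ _ b * (u⁻¹ : Rˣ), ?_⟩
    have hm' : m = algebraMap A R a * (u⁻¹ : Rˣ) := by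
      rw [Units.eq_mul_inv_iff_mul_eq, hu]
      exact has
    rw [hm', map_mul, map_mul, ← hA, hb, ← hA]
    ring
  · obtain ⟨s, hs, hsf⟩ := key f hfr
    exact hs (hPf s hsf)

namespace NormalVariety

variable {k : Type u} [Field k]

/-- A rational function without poles in codimension one on an affine open set is regular. -/
theorem mem_range_of_ord_nonneg (X : NormalVariety k) {W : X.toScheme.Opens} (hW : IsAffineOpen W)
    [Nonempty W] {f : X.FunctionField} (hf : f ≠ 0)
    (h : ∀ E : X.PrimeDivisor, E.1 ∈ W → 0 ≤ X.ord f E) :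
    f ∈ Set.range (algebraMap Γ(X.toScheme, W) X.FunctionField) := by
  by_contra hfr
  have : IsNoetherianRing Γ(X.toScheme, W) :=
    IsLocallyNoetherian.component_noetherian ⟨W, hW⟩
  obtain ⟨P, hP, hR⟩ := exists_prime_isDiscreteValuationRing hfr
  let x : X.toScheme := hW.fromSpec ⟨P, hP⟩
  have hx : x ∈ W := by
    have : x ∈ Set.range hW.fromSpec := ⟨_, rfl⟩
    rwa [hW.range_fromSpec] at this
  let := X.toScheme.presheaf.algebra_section_stalk ⟨x, hx⟩
  have htower : IsScalarTower Γ(X.toScheme, W) (X.toScheme.presheaf.stalk x) X.FunctionField :=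
    functionField_isScalarTower X.toScheme W ⟨x, hx⟩
  have hloc : IsLocalization.AtPrime (X.toScheme.presheaf.stalk x) P :=
    hW.isLocalization_stalk' ⟨P, hP⟩ hx
  have := X.isIntegrallyClosed_stalk x
  obtain ⟨hdvr, hfx⟩ := hR (X.toScheme.presheaf.stalk x)
  let E : X.PrimeDivisor := ⟨x, (X.isDiscreteValuationRing_stalk_iff x).mp hdvr⟩
  have hE := h E hx
  rw [ord_eq_dvrOrd, dvrOrd_nonneg_iff hf] at hE
  exact hfx hE

/-- A rational function whose divisor is trivial around `x` is a unit at `x`. -/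
theorem exists_isUnit_of_ord_eq_zero (X : NormalVariety k) {U : X.toScheme.Opens} {x : X.toScheme}
    (hx : x ∈ U) {f : X.FunctionField} (hf : f ≠ 0)
    (h : ∀ E : X.PrimeDivisor, E.1 ∈ U → X.ord f E = 0) :
    ∃ r : X.toScheme.presheaf.stalk x, IsUnit r ∧ algebraMap _ X.FunctionField r = f := by
  obtain ⟨_, ⟨W, hW, rfl⟩, hxW, hWU⟩ :=
    X.toScheme.isBasis_affineOpens.exists_subset_of_mem_open hx U.isOpen
  have : Nonempty W := ⟨⟨x, hxW⟩⟩
  -- Neither `f` nor its inverse has a pole in codimension one on `W`, so both are regular there.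
  obtain ⟨a, ha⟩ := X.mem_range_of_ord_nonneg hW hf fun E hE => (h E (hWU hE)).ge
  obtain ⟨b, hb⟩ := X.mem_range_of_ord_nonneg hW (inv_ne_zero hf) fun E hE => by
    rw [ord_eq_dvrOrd, dvrOrd_inv, ← ord_eq_dvrOrd, h E (hWU hE), neg_zero]
  have hinj : Function.Injective (algebraMap Γ(X.toScheme, W) X.FunctionField) :=
    X.toScheme.germToFunctionField_injective W
  have hab : a * b = 1 := hinj (by rw [map_mul, ha, hb, mul_inv_cancel₀ hf, map_one])
  refine ⟨X.toScheme.presheaf.germ W x hxW a,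
    (IsUnit.of_mul_eq_one b hab).map (X.toScheme.presheaf.germ W x hxW).hom, ?_⟩
  rw [← ha, Scheme.algebraMap_germ_eq_germToFunctionField]
  rfl

namespace DominantMorphism

variable {X Y : NormalVariety k}

/-- The pull-back of rational functions is compatible with the maps of local rings. -/
theorem functionFieldMap_algebraMap (φ : DominantMorphism Y X) (y : Y.toScheme)
    (r : X.toScheme.presheaf.stalk (φ.hom y)) :
    φ.functionFieldMap (algebraMap _ X.FunctionField r) =
      algebraMap _ Y.FunctionField (φ.hom.stalkMap y r) := by
  have h := Scheme.Hom.stalkSpecializes_stalkMap φ.hom (genericPoint Y.toScheme) y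
    ((genericPoint_spec Y.toScheme).specializes trivial)
  have h2 : X.toScheme.presheaf.stalkSpecializes
      ((genericPoint_spec X.toScheme).specializes (y := φ.hom y) trivial) ≫ φ.functionFieldHom =
      φ.hom.stalkMap y ≫ Y.toScheme.presheaf.stalkSpecializes
        ((genericPoint_spec Y.toScheme).specializes trivial) := by
    rw [← h, functionFieldHom, TopCat.Presheaf.stalkSpecializes_comp_assoc]
  exact congrArg (fun f => f.hom r) h2

theorem functionFieldMap_injective (φ : DominantMorphism Y X) :
    Function.Injective φ.functionFieldMap :=
  φ.functionFieldMap.toRingHom.injective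

/-- The pull-back of a unit at `φ(E)` has order zero along `E`. -/
theorem ord_functionFieldMap_eq_zero (φ : DominantMorphism Y X) (E : Y.PrimeDivisor)
    {U : X.toScheme.Opens} (hx : φ.hom E.1 ∈ U) {f : X.FunctionField} (hf : f ≠ 0)
    (h : ∀ E : X.PrimeDivisor, E.1 ∈ U → X.ord f E = 0) :
    Y.ord (φ.functionFieldMap f) E = 0 := by
  obtain ⟨r, hr, rfl⟩ := X.exists_isUnit_of_ord_eq_zero hx hf h
  rw [functionFieldMap_algebraMap, ord_eq_dvrOrd, dvrOrd_eq_zero_iff]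
  · exact ⟨_, hr.map (φ.hom.stalkMap E.1).hom, rfl⟩
  · rw [← functionFieldMap_algebraMap]
    exact (map_ne_zero_iff _ φ.functionFieldMap_injective).mpr hf

/-- The coefficient of the pull-back does not depend on the local equation. -/
theorem pullback_eq (φ : DominantMorphism Y X) {D : X.PrimeDivisor → ℚ} (E : Y.PrimeDivisor)
    {m : ℕ} {f : X.FunctionField} (hf : X.IsLocalEquation D (φ.hom E.1) m f) :
    φ.pullback D E = (Y.ord (φ.functionFieldMap f) E : ℚ) / m := by
  have hex : ∃ p : ℕ × X.FunctionField, X.IsLocalEquation D (φ.hom E.1) p.1 p.2 := ⟨(m, f), hf⟩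
  rw [pullback, dif_pos hex]
  obtain ⟨hm, hf0, U, hU, hUD⟩ := hf
  obtain ⟨hm', hf0', U', hU', hUD'⟩ := hex.choose_spec
  set m' := hex.choose.1
  set f' := hex.choose.2
  have hinj := φ.functionFieldMap_injective
  have h0 : φ.functionFieldMap f ≠ 0 := (map_ne_zero_iff _ hinj).mpr hf0
  have h0' : φ.functionFieldMap f' ≠ 0 := (map_ne_zero_iff _ hinj).mpr hf0'
  -- Both `f ^ m'` and `f' ^ m` are equations of `m m' D` near `φ(E)`, so their quotient is a unit
  -- there and its pull-back has order zero.
  have key := φ.ord_functionFieldMap_eq_zero E (U := U ⊓ U') ⟨hU, hU'⟩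
    (f := f ^ m' * (f' ^ m)⁻¹) (mul_ne_zero (pow_ne_zero _ hf0) (inv_ne_zero (pow_ne_zero _ hf0')))
    (by
      intro F hF
      have h1 := hUD F hF.1
      have h2 := hUD' F hF.2
      rw [ord_eq_dvrOrd] at h1 h2 ⊢
      rw [dvrOrd_mul (pow_ne_zero _ hf0) (inv_ne_zero (pow_ne_zero _ hf0')), dvrOrd_inv,
        dvrOrd_pow, dvrOrd_pow]
      have : ((m' * dvrOrd (X.toScheme.presheaf.stalk F.1) f +
          -(m * dvrOrd (X.toScheme.presheaf.stalk F.1) f') : ℤ) : ℚ) = 0 := by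
        push_cast
        rw [← h1, ← h2]
        ring
      exact_mod_cast this)
  rw [map_mul, map_inv₀, map_pow, map_pow, ord_eq_dvrOrd,
    dvrOrd_mul (pow_ne_zero _ h0) (inv_ne_zero (pow_ne_zero _ h0')), dvrOrd_inv,
    dvrOrd_pow, dvrOrd_pow, ← ord_eq_dvrOrd, ← ord_eq_dvrOrd] at key
  have key' : (m' : ℚ) * Y.ord (φ.functionFieldMap f) E = m * Y.ord (φ.functionFieldMap f') E := by
    exact_mod_cast (by linarith :
      (m' : ℤ) * Y.ord (φ.functionFieldMap f) E = m * Y.ord (φ.functionFieldMap f') E)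
  rw [div_eq_div_iff (by positivity) (by positivity)]
  linarith

end DominantMorphism

end NormalVariety

end

/-! ### Affine normal varieties and their morphisms to `X`. -/

noncomputable section

namespace NormalVariety

variable {k : Type u} [Field k]

section affine

variable (k) (B : Type u) [CommRing B] [IsDomain B] [Algebra k B]

/-- The spectrum of a normal finitely generated domain. -/
def spec [Algebra.FiniteType k B] [IsIntegrallyClosed B] : NormalVariety k where
  toScheme := Spec (CommRingCat.of B)
  str := Spec.map (CommRingCat.ofHom (algebraMap k B))
  isIntegral := inferInstance
  isSeparated := inferInstance
  locallyOfFiniteType := by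
    rw [HasRingHomProperty.Spec_iff (P := @LocallyOfFiniteType), CommRingCat.hom_ofHom]
    exact RingHom.finiteType_algebraMap.mpr inferInstance
  quasiCompact := inferInstance
  isIntegrallyClosed_stalk y := by
    have hy : (PrimeSpectrum.asIdeal y).IsPrime := PrimeSpectrum.isPrime y
    let : Algebra B ((Spec (CommRingCat.of B)).presheaf.stalk y) :=
      StructureSheaf.stalkAlgebra B y
    have : IsLocalization.AtPrime ((Spec (CommRingCat.of B)).presheaf.stalk y) (PrimeSpectrum.asIdeal y) :=
      StructureSheaf.IsLocalization.to_stalk B y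
    exact isIntegrallyClosed_of_isLocalization _ (PrimeSpectrum.asIdeal y).primeCompl
      (PrimeSpectrum.asIdeal y).primeCompl_le_nonZeroDivisors

variable {B} [Algebra.FiniteType k B] [IsIntegrallyClosed B]

/-- The homomorphism from `B` to the local rings of its spectrum. -/
def specToStalk (y : (spec k B).toScheme) : B →+* (spec k B).toScheme.presheaf.stalk y :=
  (StructureSheaf.toStalk B y).hom

theorem algebraMap_specToStalk (y : (spec k B).toScheme) (b : B) :
    algebraMap _ (spec k B).FunctionField (specToStalk k y b) =
      specToStalk k (genericPoint (spec k B).toScheme) b :=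
  congrArg (fun f => f.hom b) (StructureSheaf.toStalk_stalkSpecializes (R := B)
    (x := genericPoint (spec k B).toScheme) (y := y)
    ((genericPoint_spec (spec k B).toScheme).specializes trivial))

theorem exists_specToStalk (y : (spec k B).toScheme) (r : (spec k B).toScheme.presheaf.stalk y) :
    ∃ b s : B, s ∉ PrimeSpectrum.asIdeal y ∧ r * specToStalk k y s = specToStalk k y b := by
  have hy : (PrimeSpectrum.asIdeal y).IsPrime := PrimeSpectrum.isPrime y
  let : Algebra B ((spec k B).toScheme.presheaf.stalk y) := (specToStalk k y).toAlgebra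
  have : IsLocalization.AtPrime ((spec k B).toScheme.presheaf.stalk y) (PrimeSpectrum.asIdeal y) :=
    StructureSheaf.IsLocalization.to_stalk B y
  obtain ⟨⟨b, s⟩, h⟩ := IsLocalization.surj (PrimeSpectrum.asIdeal y).primeCompl r
  exact ⟨b, s, s.2, h⟩

theorem isUnit_specToStalk {y : (spec k B).toScheme} {s : B} (hs : s ∉ PrimeSpectrum.asIdeal y) :
    IsUnit (specToStalk k y s) := by
  have hy : (PrimeSpectrum.asIdeal y).IsPrime := PrimeSpectrum.isPrime y
  let : Algebra B ((spec k B).toScheme.presheaf.stalk y) := (specToStalk k y).toAlgebra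
  have : IsLocalization.AtPrime ((spec k B).toScheme.presheaf.stalk y) (PrimeSpectrum.asIdeal y) :=
    StructureSheaf.IsLocalization.to_stalk B y
  exact IsLocalization.map_units _ (⟨s, hs⟩ : (PrimeSpectrum.asIdeal y).primeCompl)

theorem specToStalk_injective (y : (spec k B).toScheme) :
    Function.Injective (specToStalk k y) := by
  have hy : (PrimeSpectrum.asIdeal y).IsPrime := PrimeSpectrum.isPrime y
  let : Algebra B ((spec k B).toScheme.presheaf.stalk y) := (specToStalk k y).toAlgebra
  have : IsLocalization.AtPrime ((spec k B).toScheme.presheaf.stalk y) (PrimeSpectrum.asIdeal y) :=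
    StructureSheaf.IsLocalization.to_stalk B y
  exact IsLocalization.injective _ (PrimeSpectrum.asIdeal y).primeCompl_le_nonZeroDivisors

end affine

section specMap

theorem fromSpec_str {X : NormalVariety k} {W : X.toScheme.Opens} (hW : IsAffineOpen W) :
    hW.fromSpec ≫ X.str = Spec.map (X.scalarsOn W) := by
  rw [← IsAffineOpen.SpecMap_appLE_fromSpec X.str (isAffineOpen_top _) hW le_top]
  rw [scalarsOn_eq, Spec.map_comp, IsAffineOpen.fromSpec_top, Scheme.isoSpec_Spec_inv]

theorem isDominant_specMap_fromSpec {X : Scheme.{u}} [IsIntegral X] {W : X.Opens}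
    (hW : IsAffineOpen W) [Nonempty W] {B : Type u} [CommRing B] {α : Γ(X, W) →+* B}
    (hα : Function.Injective α) :
    IsDominant (Spec.map (CommRingCat.ofHom α) ≫ hW.fromSpec) := by
  have h1 : IsDominant (Spec.map (CommRingCat.ofHom α)) := by
    refine ⟨(PrimeSpectrum.denseRange_comap_iff_ker_le_nilRadical α).mpr ?_⟩
    rw [(RingHom.injective_iff_ker_eq_bot α).mp hα]
    exact bot_le
  have h2 : IsDominant hW.fromSpec := by
    refine ⟨?_⟩
    rw [DenseRange, hW.range_fromSpec]
    exact W.isOpen.dense (by simpa using ‹Nonempty W›)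
  infer_instance

/-- Connects the scheme morphism with the ring map `α`, so that pull-backs of rational functions can
be computed in `B`. -/
theorem specMap_fromSpec_app_germ {X : Scheme.{u}} {W : X.Opens} (hW : IsAffineOpen W)
    {B : Type u} [CommRing B] (α : Γ(X, W) →+* B) (y : Spec (CommRingCat.of B))
    (hy : (Spec.map (CommRingCat.ofHom α) ≫ hW.fromSpec) y ∈ W) :
    (Spec.map (CommRingCat.ofHom α) ≫ hW.fromSpec).app W ≫
      (Spec (CommRingCat.of B)).presheaf.germ _ y hy =
      CommRingCat.ofHom α ≫ StructureSheaf.toStalk B y := by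
  have h1 : CommRingCat.ofHom α ≫ StructureSheaf.toStalk B y =
      CommRingCat.ofHom α ≫ (Scheme.ΓSpecIso (CommRingCat.of B)).inv ≫
        (Spec (CommRingCat.of B)).presheaf.germ ⊤ y trivial := rfl
  change (hW.fromSpec.app W ≫ (Spec.map (CommRingCat.ofHom α)).app (hW.fromSpec ⁻¹ᵁ W)) ≫
    (Spec (CommRingCat.of B)).presheaf.germ
      (Spec.map (CommRingCat.ofHom α) ⁻¹ᵁ hW.fromSpec ⁻¹ᵁ W) y hy = _
  rw [h1, hW.fromSpec_app_self, Scheme.ΓSpecIso_inv_naturality_assoc, Category.assoc,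
    Category.assoc, Scheme.Hom.naturality_assoc]
  have h2 := (Spec (CommRingCat.of B)).presheaf.germ_res
    ((TopologicalSpace.Opens.map (Spec.map (CommRingCat.ofHom α)).base).map
      (eqToHom hW.fromSpec_preimage_self)) y hy
  exact congrArg (fun z => (Scheme.ΓSpecIso Γ(X, W)).inv ≫
    (Spec.map (CommRingCat.ofHom α)).app ⊤ ≫ z) h2

variable {X : NormalVariety k} {W : X.toScheme.Opens} (hW : IsAffineOpen W) [Nonempty W]
  {B : Type u} [CommRing B] [IsDomain B] [Algebra k B] [Algebra.FiniteType k B]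
  [IsIntegrallyClosed B] (α : Γ(X.toScheme, W) →+* B) (hα : Function.Injective α)
  (hk : α.comp (X.scalarsOn W).hom = algebraMap k B)

/-- The morphism `Spec B → X` given by an injective homomorphism `Γ(X, W) → B` for an affine open
`W ⊆ X`. -/
def specMap : DominantMorphism (spec k B) X where
  hom := Spec.map (CommRingCat.ofHom α) ≫ hW.fromSpec
  comp_str := by
    have h : (Spec.map (CommRingCat.ofHom α) ≫ hW.fromSpec) ≫ X.str =
        Spec.map (CommRingCat.ofHom (algebraMap k B)) := by
      rw [Category.assoc, fromSpec_str, ← Spec.map_comp, ← hk]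
      rfl
    exact h
  isDominant := isDominant_specMap_fromSpec hW hα

theorem functionFieldMap_specMap (a : Γ(X.toScheme, W)) :
    (specMap hW α hα hk).functionFieldMap (algebraMap _ X.FunctionField a) =
      specToStalk k (genericPoint (spec k B).toScheme) (α a) := by
  have h := specMap_fromSpec_app_germ hW α (genericPoint (spec k B).toScheme)
    ((specMap hW α hα hk).map_genericPoint.symm ▸
      ((genericPoint_spec X.toScheme).mem_open_set_iff W.isOpen).mpr (by simpa using ‹Nonempty W›))
  have h2 : X.toScheme.germToFunctionField W ≫ (specMap hW α hα hk).functionFieldHom =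
      CommRingCat.ofHom α ≫ StructureSheaf.toStalk B (genericPoint (spec k B).toScheme) := by
    rw [← h, DominantMorphism.functionFieldHom, Scheme.germToFunctionField,
      TopCat.Presheaf.germ_stalkSpecializes_assoc, Scheme.Hom.germ_stalkMap]
    rfl
  exact congrArg (fun f => f.hom a) h2

end specMap

end NormalVariety

end

/-! ### Ramification indices and the birational model. -/

noncomputable section

/-- An extension of discrete valuations has a ramification index. -/
theorem exists_ramificationIdx {R K R' L : Type*} [CommRing R] [IsDomain R]
    [IsDiscreteValuationRing R] [Field K] [Algebra R K] [IsFractionRing R K]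
    [CommRing R'] [IsDomain R'] [IsDiscreteValuationRing R'] [Field L] [Algebra R' L]
    [IsFractionRing R' L] (ψ : K →+* L)
    (h : ∀ f, f ∈ Set.range (algebraMap R K) ↔ ψ f ∈ Set.range (algebraMap R' L)) :
    ∃ e : ℕ, 1 ≤ e ∧ ∀ f : K, f ≠ 0 → dvrOrd R' (ψ f) = e * dvrOrd R f := by
  have hψ : ∀ {f : K}, f ≠ 0 → ψ f ≠ 0 := fun hf => (map_ne_zero ψ).mpr hf
  have hnonneg : ∀ f : K, f ≠ 0 → (0 ≤ dvrOrd R f ↔ 0 ≤ dvrOrd R' (ψ f)) := fun f hf => by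
    rw [dvrOrd_nonneg_iff hf, dvrOrd_nonneg_iff (hψ hf), h]
  have hinv : ∀ f : K, f ≠ 0 → (dvrOrd R f ≤ 0 ↔ dvrOrd R' (ψ f) ≤ 0) := fun f hf => by
    have := hnonneg f⁻¹ (inv_ne_zero hf)
    rwa [map_inv₀, dvrOrd_inv, dvrOrd_inv, neg_nonneg, neg_nonneg] at this
  obtain ⟨ϖ, hϖ⟩ := IsDiscreteValuationRing.exists_irreducible R
  set t : K := algebraMap R K ϖ with ht
  have ht0 : t ≠ 0 := (map_ne_zero_iff _ (IsFractionRing.injective R K)).mpr hϖ.ne_zero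
  have ht1 : dvrOrd R t = 1 := dvrOrd_irreducible hϖ
  have hpos : 0 < dvrOrd R' (ψ t) := by
    rw [← not_le, ← hinv t ht0, ht1]
    norm_num
  -- The index is the order of the image of a uniformizer `t`. Dividing `f` by the appropriate power
  -- of `t` gives a unit, and units have order zero on both sides.
  refine ⟨(dvrOrd R' (ψ t)).toNat, by omega, fun f hf => ?_⟩
  rw [Int.toNat_of_nonneg hpos.le]
  have hz : t ^ (-dvrOrd R f) ≠ 0 := zpow_ne_zero _ ht0
  have h0 : dvrOrd R (f * t ^ (-dvrOrd R f)) = 0 := by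
    rw [dvrOrd_mul hf hz, dvrOrd_zpow, ht1]
    ring
  have h1 : dvrOrd R' (ψ (f * t ^ (-dvrOrd R f))) = 0 :=
    le_antisymm ((hinv _ (mul_ne_zero hf hz)).mp h0.le) ((hnonneg _ (mul_ne_zero hf hz)).mp h0.ge)
  rw [map_mul, map_zpow₀, dvrOrd_mul (hψ hf) (zpow_ne_zero _ (hψ ht0)), dvrOrd_zpow] at h1
  linarith

/-- A noetherian local domain that is a valuation ring and not a field is a discrete valuation
ring. -/
theorem isDiscreteValuationRing_of_forall_mem {R K : Type*} [CommRing R] [IsDomain R]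
    [IsLocalRing R] [IsNoetherianRing R] [Field K] [Algebra R K] [IsFractionRing R K]
    (h : ∀ f : K, f ∈ Set.range (algebraMap R K) ∨ f⁻¹ ∈ Set.range (algebraMap R K))
    (h' : ∃ f : K, f ∉ Set.range (algebraMap R K)) : IsDiscreteValuationRing R := by
  have hnf : ¬ IsField R := by
    intro hf
    obtain ⟨f, hf'⟩ := h'
    exact hf' ((IsFractionRing.surjective_iff_isField (R := R) (K := K)).mpr hf f)
  have hval : ValuationRing R := (ValuationRing.iff_isInteger_or_isInteger R K).mpr h
  exact ((IsDiscreteValuationRing.TFAE R hnf).out 0 1).mpr hval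

namespace NormalVariety

variable {k : Type u} [Field k]

/-- Given a separable extension of function fields induced by `φ : Y' → X`, the restriction to
`k(X)` of the valuation of a prime divisor `E'` on `Y'` is the valuation of a prime divisor on a
normal variety birational over `X`. -/
theorem exists_birational_model [PerfectField k] {X Y' : NormalVariety k}
    (φ : DominantMorphism Y' X) (hφ : φ.IsSeparable) (E' : Y'.PrimeDivisor)
    {U : X.toScheme.Opens} (hU : φ.hom E'.1 ∈ U) :
    ∃ (Y : NormalVariety k) (π : DominantMorphism Y X) (E : Y.PrimeDivisor),
      π.IsBirational ∧ π.hom E.1 ∈ U ∧ ∀ f : X.FunctionField,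
        π.functionFieldMap f ∈ Set.range
          (algebraMap (Y.toScheme.presheaf.stalk E.1) Y.FunctionField) ↔
        φ.functionFieldMap f ∈ Set.range
          (algebraMap (Y'.toScheme.presheaf.stalk E'.1) Y'.FunctionField) := by
  classical
  -- Keeping the model over an affine `W ⊆ U` puts the image of the new divisor in `U`, so a local
  -- equation on `U` serves for both divisors.
  obtain ⟨_, ⟨W, hW, rfl⟩, hxW, hWU⟩ :=
    X.toScheme.isBasis_affineOpens.exists_subset_of_mem_open hU U.isOpen
  have hne : Nonempty W := ⟨⟨_, hxW⟩⟩
  let A := Γ(X.toScheme, W)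
  let : Algebra k A := (X.scalarsOn W).hom.toAlgebra
  have hAk : ∀ r : k, algebraMap A X.FunctionField (algebraMap k A r) =
      algebraMap k X.FunctionField r := fun r =>
    congrArg (fun f => f.hom r) (X.scalarsOn_germ W (genericPoint X.toScheme) _)
  let iA : A →ₐ[k] X.FunctionField := { algebraMap A X.FunctionField with commutes' := hAk }
  have hft : Algebra.FiniteType k A := X.finiteType_scalarsOn hW
  obtain ⟨T, hT⟩ := hft.out
  have hAreg : ∀ a : A, φ.functionFieldMap (iA a) ∈ Set.range
      (algebraMap (Y'.toScheme.presheaf.stalk E'.1) Y'.FunctionField) := by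
    intro a
    have h1 : iA a = algebraMap (X.toScheme.presheaf.stalk (φ.hom E'.1)) X.FunctionField
        (X.toScheme.presheaf.germ W _ hxW a) :=
      (Scheme.algebraMap_germ_eq_germToFunctionField X.toScheme hxW a).symm
    rw [h1, φ.functionFieldMap_algebraMap]
    exact ⟨_, rfl⟩
  -- Requiring `B` to contain generators of `A` gives a map from `Spec B` to `W`. The element `f₀`
  -- shows that the restricted valuation is nontrivial.
  obtain ⟨⟨f₀, hf₀, hf₀r, hf₀n⟩, B, _, _, _, ι, ρ, hι, hBft, hBcl, hTB, hρ, hfrac⟩ :=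
    exists_finiteType_model_of_comap (R' := Y'.toScheme.presheaf.stalk E'.1)
      φ.functionFieldMap hφ (T.image iA) (by
        intro a ha
        obtain ⟨b, -, rfl⟩ := Finset.mem_image.mp ha
        exact hAreg b)
  have hArange : ∀ a : A, ∃ b : B, ι b = iA a := by
    intro a
    have ha : a ∈ Algebra.adjoin k (T : Set A) := hT ▸ Algebra.mem_top
    have h2 : Algebra.adjoin k (T : Set A) ≤ ι.range.comap iA :=
      Algebra.adjoin_le fun a ha => hTB _ (Finset.mem_image_of_mem _ ha)
    exact h2 ha
  choose α₀ hα₀ using hArange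
  let α : A →+* B :=
    { toFun := α₀
      map_one' := hι (by rw [hα₀, map_one, map_one])
      map_mul' := fun a b => hι (by simp [hα₀])
      map_zero' := hι (by rw [hα₀, map_zero, map_zero])
      map_add' := fun a b => hι (by simp [hα₀]) }
  have hια : ∀ a, ι (α a) = algebraMap A X.FunctionField a := hα₀
  have hAinj : Function.Injective (algebraMap A X.FunctionField) :=
    X.toScheme.germToFunctionField_injective W
  have hα : Function.Injective α := fun a b hab => hAinj (by rw [← hια, ← hια, hab])
  have hk : α.comp (X.scalarsOn W).hom = algebraMap k B := by
    refine RingHom.ext fun r => hι ?_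
    rw [RingHom.comp_apply, hια, ι.commutes]
    exact hAk r
  let Y := spec k B
  let π : DominantMorphism Y X := specMap hW α hα hk
  let j : B →+* Y.FunctionField := specToStalk k (genericPoint Y.toScheme)
  have hj : Function.Injective j := specToStalk_injective k _
  have hfr : IsFractionRing A X.FunctionField :=
    functionField_isFractionRing_of_isAffineOpen X.toScheme W hW
  have hπA : ∀ a : A, π.functionFieldMap (algebraMap A X.FunctionField a) = j (α a) :=
    functionFieldMap_specMap hW α hα hk
  have hπι : ∀ b : B, π.functionFieldMap (ι b) = j b := by
    intro b
    obtain ⟨a, s, hs, has⟩ := IsFractionRing.div_surjective (A := A) (ι b)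
    have hs0 : algebraMap A X.FunctionField s ≠ 0 :=
      (map_ne_zero_iff _ hAinj).mpr (nonZeroDivisors.ne_zero hs)
    have h1 : b * α s = α a := hι (by
      rw [map_mul, hια, hια, ← has, div_mul_cancel₀ _ hs0])
    have h2 : j (α s) ≠ 0 := by
      rw [← hπA]
      exact (map_ne_zero_iff _ π.functionFieldMap_injective).mpr hs0
    rw [← has, map_div₀, hπA, hπA, ← h1, map_mul, mul_div_cancel_right₀ _ h2]
  -- The centre on `Spec B` of the valuation of `E'`; its local ring will be the restricted
  -- valuation ring.
  let P : Ideal B := (IsLocalRing.maximalIdeal (Y'.toScheme.presheaf.stalk E'.1)).comap ρ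
  have hP : P.IsPrime := Ideal.comap_isPrime _ _
  let y : Y.toScheme := (⟨P, hP⟩ : PrimeSpectrum B)
  have hyP : ∀ s : B, s ∉ PrimeSpectrum.asIdeal y ↔ IsUnit (ρ s) := fun s => not_not
  have hbir : π.IsBirational := by
    refine ⟨π.functionFieldMap_injective, fun z => ?_⟩
    obtain ⟨b, s, hs, hbs⟩ := exists_specToStalk k (genericPoint Y.toScheme) z
    have hs0 : j s ≠ 0 := (isUnit_specToStalk k hs).ne_zero
    refine ⟨ι b / ι s, ?_⟩
    rw [map_div₀, hπι, hπι, div_eq_iff hs0]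
    exact hbs.symm
  have hiff : ∀ f : X.FunctionField,
        π.functionFieldMap f ∈ Set.range
          (algebraMap (Y.toScheme.presheaf.stalk y) Y.FunctionField) ↔
        φ.functionFieldMap f ∈ Set.range
          (algebraMap (Y'.toScheme.presheaf.stalk E'.1) Y'.FunctionField) := by
    intro f
    constructor
    · rintro ⟨r, hr⟩
      obtain ⟨b, s, hs, hbs⟩ := exists_specToStalk k y r
      obtain ⟨u, hu⟩ := (hyP s).mp hs
      have h1 := congrArg (algebraMap (Y.toScheme.presheaf.stalk y) Y.FunctionField) hbs
      rw [map_mul, hr, algebraMap_specToStalk, algebraMap_specToStalk] at h1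
      have h2 : f * ι s = ι b := π.functionFieldMap_injective (by
        rw [map_mul, hπι, hπι]; exact h1)
      have h3 := congrArg φ.functionFieldMap h2
      rw [map_mul, ← hρ, ← hρ] at h3
      refine ⟨ρ b * (u⁻¹ : (Y'.toScheme.presheaf.stalk E'.1)ˣ), ?_⟩
      rw [map_mul, ← h3, ← hu, mul_assoc, ← map_mul, Units.mul_inv, map_one, mul_one]
    · intro hf
      obtain ⟨b, s, hs, hbs⟩ := hfrac f hf
      obtain ⟨u, hu⟩ := isUnit_specToStalk k ((hyP s).mpr hs)
      have h1 := congrArg π.functionFieldMap hbs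
      rw [map_mul, hπι, hπι] at h1
      refine ⟨specToStalk k y b * (u⁻¹ : (Y.toScheme.presheaf.stalk y)ˣ), ?_⟩
      rw [map_mul, algebraMap_specToStalk]
      change j b * _ = _
      rw [← h1, show j s = algebraMap (Y.toScheme.presheaf.stalk y) Y.FunctionField
        (specToStalk k y s) from (algebraMap_specToStalk k y s).symm, ← hu, mul_assoc, ← map_mul,
        Units.mul_inv, map_one, mul_one]
  -- The local ring is noetherian and, by `hiff`, a valuation ring that is not a field. Hence it is
  -- discrete, and the centre has codimension one.
  have hdvr : IsDiscreteValuationRing (Y.toScheme.presheaf.stalk y) := by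
    refine isDiscreteValuationRing_of_forall_mem (K := Y.FunctionField) (fun z => ?_)
      ⟨π.functionFieldMap f₀⁻¹, fun h => hf₀n ((hiff _).mp h)⟩
    obtain ⟨f, rfl⟩ := hbir.2 z
    rw [← map_inv₀, hiff, hiff, map_inv₀]
    exact ValuationRing.isInteger_or_isInteger (Y'.toScheme.presheaf.stalk E'.1) _
  refine ⟨Y, π, ⟨y, (Y.isDiscreteValuationRing_stalk_iff y).mp hdvr⟩, hbir, hWU ?_, hiff⟩
  have : π.hom y ∈ Set.range hW.fromSpec := ⟨_, rfl⟩
  rwa [hW.range_fromSpec] at this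

end NormalVariety

end

/-! ### Discrepancies along separable morphisms. -/

noncomputable section

section fields

variable {k K L M : Type u} [Field k] [Field K] [Field L] [Field M] [Algebra k K] [Algebra k L]
  [Algebra k M]

theorem AlgHom.IsSeparableExt.of_bijective {φ : K →ₐ[k] L} (hφ : Function.Bijective φ) :
    φ.IsSeparableExt := by
  let : Algebra K L := φ.toRingHom.toAlgebra
  exact AlgEquiv.Algebra.isSeparable (AlgEquiv.ofBijective (Algebra.ofId K L) hφ)

theorem AlgHom.IsSeparableExt.comp {φ : K →ₐ[k] L} {ψ : L →ₐ[k] M} (hφ : φ.IsSeparableExt)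
    (hψ : ψ.IsSeparableExt) : (ψ.comp φ).IsSeparableExt := by
  let : Algebra K L := φ.toRingHom.toAlgebra
  let : Algebra L M := ψ.toRingHom.toAlgebra
  let : Algebra K M := (ψ.comp φ).toRingHom.toAlgebra
  have : IsScalarTower K L M := IsScalarTower.of_algebraMap_eq fun _ => rfl
  have : Algebra.IsSeparable K L := hφ
  have : Algebra.IsSeparable L M := hψ
  exact Algebra.IsSeparable.trans K L M

theorem AlgHom.IsSeparableExt.of_comp {φ : K →ₐ[k] L} {ψ : L →ₐ[k] M}
    (h : (ψ.comp φ).IsSeparableExt) : ψ.IsSeparableExt := by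
  let : Algebra K L := φ.toRingHom.toAlgebra
  let : Algebra L M := ψ.toRingHom.toAlgebra
  let : Algebra K M := (ψ.comp φ).toRingHom.toAlgebra
  have : IsScalarTower K L M := IsScalarTower.of_algebraMap_eq fun _ => rfl
  have : Algebra.IsSeparable K M := h
  exact Algebra.isSeparable_tower_top_of_isSeparable K L M

end fields

namespace NormalVariety

variable {k : Type u} [Field k]

theorem IsTopForm.exists_eq_smul {X : NormalVariety k} {ω ω' : X.RationalForm}
    (hω : X.IsTopForm ω) (hω' : X.IsTopForm ω') : ∃ h : X.FunctionField, h ≠ 0 ∧ ω' = h • ω := by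
  obtain ⟨x, hx⟩ := exists_span_D_eq_top_of_field (k := k) (K := X.FunctionField)
    (n := X.topDegree) rfl
  obtain ⟨c, hc⟩ := exists_eq_smul_ιMulti hx hω.1
  obtain ⟨c', hc'⟩ := exists_eq_smul_ιMulti hx hω'.1
  have hc0 : c ≠ 0 := by
    rintro rfl
    exact hω.2 (by rw [hc, zero_smul])
  have hc0' : c' ≠ 0 := by
    rintro rfl
    exact hω'.2 (by rw [hc', zero_smul])
  refine ⟨c' / c, div_ne_zero hc0' hc0, ?_⟩
  rw [hc, hc', smul_smul, div_mul_cancel₀ _ hc0]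

theorem IsTopForm.ordForm_smul [PerfectField k] {X : NormalVariety k} {ω : X.RationalForm}
    (hω : X.IsTopForm ω) {h : X.FunctionField} (hh : h ≠ 0) (E : X.PrimeDivisor) :
    X.ordForm (h • ω) E = X.ord h E + X.ordForm ω E := by
  rw [ordForm_eq_dvrOrdForm, ordForm_eq_dvrOrdForm, ord_eq_dvrOrd]
  exact dvrOrdForm_smul_form rfl hω.1 hω.2 hh

namespace DominantMorphism

variable {X Y Z : NormalVariety k}

theorem topDegree_eq {φ : DominantMorphism Y X} (hφ : φ.IsSeparable) : Y.topDegree = X.topDegree :=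
  finrank_kaehlerDifferential_eq φ.functionFieldMap hφ

theorem isTopForm_pullbackForm {φ : DominantMorphism Y X} (hφ : φ.IsSeparable)
    {ω : X.RationalForm} (hω : X.IsTopForm ω) : Y.IsTopForm (φ.pullbackForm ω) := by
  have h := formPullback_mem_and_ne_zero φ.functionFieldMap hφ (n := X.topDegree) rfl hω.1 hω.2
  rw [← topDegree_eq hφ] at h
  exact h

theorem IsBirational.isSeparable {φ : DominantMorphism Y X} (hφ : φ.IsBirational) :
    φ.IsSeparable :=
  AlgHom.IsSeparableExt.of_bijective hφ

/-- The composition of dominant morphisms. -/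
def comp (ψ : DominantMorphism Z Y) (φ : DominantMorphism Y X) : DominantMorphism Z X where
  hom := ψ.hom ≫ φ.hom
  comp_str := by rw [Category.assoc, φ.comp_str, ψ.comp_str]
  isDominant := by
    have := ψ.isDominant
    have := φ.isDominant
    infer_instance

theorem functionFieldMap_comp (ψ : DominantMorphism Z Y) (φ : DominantMorphism Y X) :
    (ψ.comp φ).functionFieldMap = ψ.functionFieldMap.comp φ.functionFieldMap := by
  -- The function field is the fraction field of the local ring at the image of any point `z`, so it
  -- suffices to compare the maps on that local ring.
  obtain ⟨z⟩ : Nonempty Z.toScheme := inferInstance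
  have key : ∀ r : X.toScheme.presheaf.stalk (φ.hom (ψ.hom z)),
      (ψ.comp φ).functionFieldMap (algebraMap _ X.FunctionField r) =
        ψ.functionFieldMap (φ.functionFieldMap (algebraMap _ X.FunctionField r)) := by
    intro r
    rw [functionFieldMap_algebraMap, functionFieldMap_algebraMap]
    refine ((ψ.comp φ).functionFieldMap_algebraMap z r).trans ?_
    exact congrArg (algebraMap _ Z.FunctionField)
      (congrArg (fun f => f.hom r) (Scheme.Hom.stalkMap_comp ψ.hom φ.hom z))
  ext f
  obtain ⟨a, b, -, rfl⟩ := IsFractionRing.div_surjective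
    (A := X.toScheme.presheaf.stalk (φ.hom (ψ.hom z))) f
  rw [map_div₀, key, key, AlgHom.comp_apply, map_div₀, map_div₀]

theorem pullbackForm_comp (ψ : DominantMorphism Z Y) (φ : DominantMorphism Y X)
    {ω : X.RationalForm} (hω : X.IsTopForm ω) :
    (ψ.comp φ).pullbackForm ω = ψ.pullbackForm (φ.pullbackForm ω) := by
  rw [pullbackForm, pullbackForm, pullbackForm, functionFieldMap_comp]
  exact (formPullback_comp_apply φ.functionFieldMap ψ.functionFieldMap rfl hω.1).symm

theorem IsSeparable.comp {ψ : DominantMorphism Z Y} {φ : DominantMorphism Y X}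
    (hψ : ψ.IsSeparable) (hφ : φ.IsSeparable) : (ψ.comp φ).IsSeparable := by
  have h := AlgHom.IsSeparableExt.comp (φ := φ.functionFieldMap) (ψ := ψ.functionFieldMap) hφ hψ
  rwa [← functionFieldMap_comp] at h

end DominantMorphism

/-- If `(X, Δ)` is log canonical, then the coefficients of `K_Y - φ^*(K_X + Δ)` are at least `-1`
for every dominant separable morphism `φ : Y → X`. -/
theorem IsLogCanonical.neg_one_le [PerfectField k] {X Y : NormalVariety k} {Δ : X.QDivisor}
    (hlc : X.IsLogCanonical Δ) {ω : X.RationalForm} (hω : X.IsTopForm ω)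
    (φ : DominantMorphism Y X) (hφ : φ.IsSeparable) (E : Y.PrimeDivisor) :
    -1 ≤ discrepancy φ ω Δ E := by
  obtain ⟨⟨m, -, hm⟩, hdisc⟩ := hlc ω hω
  obtain ⟨f, hf⟩ := hm (φ.hom E.1)
  obtain ⟨hm0, hf0, U, hU, hUD⟩ := hf
  obtain ⟨Z, π, F, hπ, hFU, hiff⟩ := exists_birational_model φ hφ E hU
  have hd := hdisc Z π hπ F
  rw [discrepancy, π.pullback_eq F ⟨hm0, hf0, U, hFU, hUD⟩] at hd
  rw [discrepancy, φ.pullback_eq E ⟨hm0, hf0, U, hU, hUD⟩]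
  let σ : X.FunctionField ≃ₐ[k] Z.FunctionField := AlgEquiv.ofBijective π.functionFieldMap hπ
  -- The fields `k(X)` and `k(Z)` are identified through `π`. Under `ψ` the local ring of `F` is the
  -- preimage of that of `E`, which provides a ramification index even without a morphism `Y → Z`.
  let ψ : Z.FunctionField →ₐ[k] Y.FunctionField := φ.functionFieldMap.comp σ.symm.toAlgHom
  have hψ : ∀ a, ψ (π.functionFieldMap a) = φ.functionFieldMap a := fun a =>
    congrArg φ.functionFieldMap (σ.symm_apply_apply a)
  have hψcomp : ψ.comp π.functionFieldMap = φ.functionFieldMap := AlgHom.ext hψ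
  have hψsep : ψ.IsSeparableExt := by
    refine AlgHom.IsSeparableExt.of_comp (φ := π.functionFieldMap) ?_
    rw [hψcomp]
    exact hφ
  obtain ⟨e, he, hord⟩ := exists_ramificationIdx (R := Z.toScheme.presheaf.stalk F.1)
    (R' := Y.toScheme.presheaf.stalk E.1) ψ.toRingHom (by
      intro z
      obtain ⟨a, rfl⟩ := hπ.2 z
      rw [hiff, ← hψ]
      rfl)
  have hπω := DominantMorphism.isTopForm_pullbackForm hπ.isSeparable hω
  have hform := mul_dvrOrdForm_add_one_le (R := Z.toScheme.presheaf.stalk F.1)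
    (R' := Y.toScheme.presheaf.stalk E.1) ψ hψsep he hord (n := Z.topDegree) rfl hπω.1 hπω.2
  have hpb : formPullback ψ (π.pullbackForm ω) = φ.pullbackForm ω := by
    rw [DominantMorphism.pullbackForm, DominantMorphism.pullbackForm, ← hψcomp]
    exact formPullback_comp_apply π.functionFieldMap ψ rfl hω.1
  have hdeg : Z.topDegree = Y.topDegree :=
    (DominantMorphism.topDegree_eq hπ.isSeparable).trans (DominantMorphism.topDegree_eq hφ).symm
  rw [hpb, ← ordForm_eq_dvrOrdForm, hdeg, ← ordForm_eq_dvrOrdForm] at hform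
  have hordf : Y.ord (φ.functionFieldMap f) E = e * Z.ord (π.functionFieldMap f) F := by
    rw [ord_eq_dvrOrd, ord_eq_dvrOrd, ← hψ]
    exact hord _ ((map_ne_zero_iff _ π.functionFieldMap_injective).mpr hf0)
  have hform' : (e : ℚ) * (Z.ordForm (π.pullbackForm ω) F + 1) ≤
      Y.ordForm (φ.pullbackForm ω) E + 1 := by exact_mod_cast hform
  have he0 : (0 : ℚ) ≤ e := e.cast_nonneg
  -- This is `e (a(F) + 1) ≥ 0`. By the inequality for forms and the scaling of `ord f` by `e`, it
  -- is a lower bound for `a(E) + 1`.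
  have hmul := mul_nonneg he0 (by linarith : (0 : ℚ) ≤ Z.ordForm (π.pullbackForm ω) F -
    (Z.ord (π.functionFieldMap f) F : ℚ) / m + 1)
  rw [hordf]
  push_cast
  rw [mul_div_assoc]
  linarith

/-- If `f` is an equation of `m D` around `φ(x)`, then `h ^ m φ^* f` is an equation of
`m (div h + φ^* D)` around `x`. -/
theorem IsLocalEquation.pullback {X Y : NormalVariety k} (φ : DominantMorphism Y X)
    {D : X.PrimeDivisor → ℚ} {y : Y.toScheme} {m : ℕ} {f : X.FunctionField}
    (hf : X.IsLocalEquation D (φ.hom y) m f) {h : Y.FunctionField} (hh : h ≠ 0) :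
    Y.IsLocalEquation (fun E => Y.ord h E + φ.pullback D E) y m
      (h ^ m * φ.functionFieldMap f) := by
  obtain ⟨hm, hf0, U, hU, hUD⟩ := hf
  have hf0' : φ.functionFieldMap f ≠ 0 := (map_ne_zero_iff _ φ.functionFieldMap_injective).mpr hf0
  refine ⟨hm, mul_ne_zero (pow_ne_zero _ hh) hf0', φ.hom ⁻¹ᵁ U, hU, fun E hE => ?_⟩
  have hm0 : (m : ℚ) ≠ 0 := by exact_mod_cast hm.ne'
  change (m : ℚ) * (Y.ord h E + φ.pullback D E) = _
  rw [φ.pullback_eq E ⟨hm, hf0, U, hE, hUD⟩, ord_eq_dvrOrd, ord_eq_dvrOrd, ord_eq_dvrOrd,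
    dvrOrd_mul (pow_ne_zero _ hh) hf0', dvrOrd_pow]
  push_cast
  field_simp

end NormalVariety

end

theorem proposition4p5 {k : Type u} [Field k] [IsAlgClosed k] (p : ℕ) (hp : 0 < p) [CharP k p]
    (X X' : NormalVariety k) (g : NormalVariety.DominantMorphism X' X)
    (hfin : IsFinite g.hom) (hsep : g.IsSeparable)
    (Δ : X.QDivisor) (Δ' : X'.QDivisor)
    (ω : X.RationalForm) (hω : X.IsTopForm ω)
    (hΔ : X.IsQCartier (X.logCanonicalDivisor ω Δ))
    (hpull : g.pullback (X.logCanonicalDivisor ω Δ) =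
      X'.logCanonicalDivisor (g.pullbackForm ω) Δ')
    (hlc : X.IsLogCanonical Δ) :
    X'.IsLogCanonical Δ' := by
  intro ω' hω'
  have hgω := NormalVariety.DominantMorphism.isTopForm_pullbackForm hsep hω
  -- Log canonicity has to be checked for every top form on `X'`. Each is `h • g^*ω`, which adds
  -- `div h` to `K_{X'} + Δ' = g^*(K_X + Δ)`.
  obtain ⟨h, hh, rfl⟩ := hgω.exists_eq_smul hω'
  have hD : X'.logCanonicalDivisor (h • g.pullbackForm ω) Δ' =
      fun E => X'.ord h E + g.pullback (X.logCanonicalDivisor ω Δ) E := by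
    funext E
    rw [hpull, NormalVariety.logCanonicalDivisor, NormalVariety.logCanonicalDivisor,
      hgω.ordForm_smul hh]
    push_cast
    ring
  obtain ⟨m, hm, hloc⟩ := hΔ
  refine ⟨⟨m, hm, fun x => ?_⟩, fun Y π hπ E => ?_⟩
  · obtain ⟨f, hf⟩ := hloc (g.hom x)
    exact ⟨_, hD ▸ hf.pullback g hh⟩
  · obtain ⟨f, hf⟩ := hloc (g.hom (π.hom E.1))
    -- The order of `h` along `E` enters both `K_Y` and the pulled-back divisor and cancels. What
    -- remains is the coefficient of `E` for the separable morphism `Y → X`.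
    have hsep' := hπ.isSeparable.comp hsep
    have hd := hlc.neg_one_le hω (π.comp g) hsep' E
    have hf0 : π.functionFieldMap (g.functionFieldMap f) ≠ 0 :=
      (map_ne_zero_iff _ π.functionFieldMap_injective).mpr
        ((map_ne_zero_iff _ g.functionFieldMap_injective).mpr hf.2.1)
    have hh0 : π.functionFieldMap h ≠ 0 := (map_ne_zero_iff _ π.functionFieldMap_injective).mpr hh
    rw [NormalVariety.discrepancy, (π.comp g).pullback_eq E hf,
      NormalVariety.DominantMorphism.functionFieldMap_comp, AlgHom.comp_apply,
      NormalVariety.DominantMorphism.pullbackForm_comp π g hω] at hd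
    have hsm : π.pullbackForm (h • g.pullbackForm ω) =
        π.functionFieldMap h • π.pullbackForm (g.pullbackForm ω) :=
      formPullback_smul π.functionFieldMap h _
    have hord : Y.ord (π.functionFieldMap (h ^ m * g.functionFieldMap f)) E =
        m * Y.ord (π.functionFieldMap h) E +
          Y.ord (π.functionFieldMap (g.functionFieldMap f)) E := by
      rw [NormalVariety.ord_eq_dvrOrd, NormalVariety.ord_eq_dvrOrd, NormalVariety.ord_eq_dvrOrd,
        map_mul, map_pow, dvrOrd_mul (pow_ne_zero _ hh0) hf0, dvrOrd_pow]
    have hm0 : (m : ℚ) ≠ 0 := by exact_mod_cast hm.ne'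
    rw [NormalVariety.discrepancy, hD, π.pullback_eq E (hf.pullback g hh), hsm,
      (NormalVariety.DominantMorphism.isTopForm_pullbackForm hπ.isSeparable hgω).ordForm_smul hh0,
      hord]
    push_cast
    rw [add_div, mul_div_cancel_left₀ _ hm0]
    linarith
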